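/- Let $(M,\Pi)$ be a smooth Poisson manifold of dimension $n=2r+s$ with $r,s\ge 0$, and let $\{f,g\}=\Pi(df,dg)$ be its Poisson bracket. Let a compact Lie group $G$ act smoothly on $M$, preserving $\Pi$, and let $m\in M$ be a fixed point of the action. Let $p_1,\dots,p_r$ be smooth $G$-invariant functions, defined on an open neighbourhood $V$ of $m$, which vanish at $m$, satisfy $\{p_i,p_j\}=0$ on $V$ for all $i,j$, and whose Hamiltonian vector fields $X_{p_i}=\{\cdot,p_i\}$ are linearly independent at $m$. Then there exist an open neighbourhood $U\subseteq V$ of $m$ and functions $q_1,\dots,q_r,z_1,\dots,z_s$ on $U$ such that: 1. the $n$ functions $(p_1,q_1,\dots,p_r,q_r,z_1,\dots,z_s)$ form a system of smooth local coordinates on $U$, centred at $m$; 2. in these coordinates the Poisson structure is $$\Pi=\sum_{i=1}^r\frac{\partial}{\partial q_i}\wedge\frac{\partial}{\partial p_i}+\sum_{i,j=1}^s g_{ij}(z)\,\frac{\partial}{\partial z_i}\wedge\frac{\partial}{\partial z_j},$$ where the $g_{ij}=-g_{ji}$ are smooth functions of $z=(z_1,\dots,z_s)$ alone, i.e. independent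 of $p_1,\dots,p_r,q_1,\dots,q_r$; 3. $U$ is $G$-invariant, and there is a group homomorphism $A$ from $G$ to the group of invertible real $s\times s$ matrices such that, for all $g\in G$ and $x\in U$, one has $p_i(g\cdot x)=p_i(x)$, $q_i(g\cdot x)=q_i(x)$ for $1\le i\le r$, and $z(g\cdot x)=A(g)\,z(x)$. Moreover, the rank of $\Pi$ at $m$ is $2r$ if and only if $g_{ij}(0)=0$ for all $i,j$. -/

import Mathlib

open scoped Manifold ContDiff Topology Matrix

/-- A bivector field `Π` on `M`, as a bundle map `sharp : T*M → TM` with `Π(α, β) = α (sharp β)`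
(no conditions imposed yet). -/
abbrev SharpMap (E M : Type*) [NormedAddCommGroup E] [NormedSpace ℝ E]
    [TopologicalSpace M] [ChartedSpace E M] : Type _ :=
  ∀ x : M, (TangentSpace 𝓘(ℝ, E) x →L[ℝ] ℝ) →ₗ[ℝ] TangentSpace 𝓘(ℝ, E) x

/-- The bracket of functions `{f, g} = Π(df, dg)` defined by `Π`. -/
noncomputable def SharpMap.bracket {E M : Type*} [NormedAddCommGroup E] [NormedSpace ℝ E]
    [TopologicalSpace M] [ChartedSpace E M] (sharp : SharpMap E M) (f g : M → ℝ) (x : M) : ℝ :=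
  mvfderiv 𝓘(ℝ, E) f x (sharp x (mvfderiv 𝓘(ℝ, E) g x))

/-- A Poisson structure on a smooth manifold `M` modelled on `E`: a bivector field (a skew-symmetric
bundle map `sharp : T*M → TM`) which is smooth and whose bracket of functions, on open sets, satisfies
the Jacobi identity. -/
structure PoissonStructure (E M : Type*) [NormedAddCommGroup E] [NormedSpace ℝ E]
    [TopologicalSpace M] [ChartedSpace E M] where
  sharp : SharpMap E M
  skew : ∀ (x : M) (α β : TangentSpace 𝓘(ℝ, E) x →L[ℝ] ℝ), α (sharp x β) = -β (sharp x α)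
  smooth : ∀ (W : Set M) (f g : M → ℝ), IsOpen W →
    ContMDiffOn 𝓘(ℝ, E) 𝓘(ℝ, ℝ) ∞ f W → ContMDiffOn 𝓘(ℝ, E) 𝓘(ℝ, ℝ) ∞ g W →
    ContMDiffOn 𝓘(ℝ, E) 𝓘(ℝ, ℝ) ∞ (SharpMap.bracket sharp f g) W
  jacobi : ∀ (W : Set M) (f g h : M → ℝ), IsOpen W →
    ContMDiffOn 𝓘(ℝ, E) 𝓘(ℝ, ℝ) ∞ f W → ContMDiffOn 𝓘(ℝ, E) 𝓘(ℝ, ℝ) ∞ g W →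
    ContMDiffOn 𝓘(ℝ, E) 𝓘(ℝ, ℝ) ∞ h W → ∀ x ∈ W,
      SharpMap.bracket sharp (SharpMap.bracket sharp f g) h x +
      SharpMap.bracket sharp (SharpMap.bracket sharp g h) f x +
      SharpMap.bracket sharp (SharpMap.bracket sharp h f) g x = 0

namespace PoissonStructure

variable {E M : Type*} [NormedAddCommGroup E] [NormedSpace ℝ E]
  [TopologicalSpace M] [ChartedSpace E M]

/-- The bivector `Π` at `x`, evaluated on two covectors: `Π(α, β)`. -/
noncomputable def bivector (P : PoissonStructure E M) (x : M)
    (α β : TangentSpace 𝓘(ℝ, E) x →L[ℝ] ℝ) : ℝ :=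
  α (P.sharp x β)

/-- The Poisson bracket `{f, g} = Π(df, dg)`. -/
noncomputable def bracket (P : PoissonStructure E M) (f g : M → ℝ) : M → ℝ :=
  SharpMap.bracket P.sharp f g

/-- The Hamiltonian vector field `X_f = {·, f}`. -/
noncomputable def hamiltonian (P : PoissonStructure E M) (f : M → ℝ) (x : M) :
    TangentSpace 𝓘(ℝ, E) x :=
  P.sharp x (mvfderiv 𝓘(ℝ, E) f x)

/-- The rank of `Π` at `x`. -/
noncomputable def rank (P : PoissonStructure E M) (x : M) : ℕ :=
  Module.finrank ℝ (LinearMap.range (P.sharp x))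

/-- A map `F : M → M` preserves `Π`: `F_* Π = Π`, i.e.
`Π_{F x}(α, β) = Π_x(α ∘ dF_x, β ∘ dF_x)`. -/
def IsPreservedBy (P : PoissonStructure E M) (F : M → M) : Prop :=
  ∀ (x : M) (α β : TangentSpace 𝓘(ℝ, E) (F x) →L[ℝ] ℝ),
    P.bivector (F x) α β =
      P.bivector x (α.comp (mfderiv 𝓘(ℝ, E) 𝓘(ℝ, E) F x))
        (β.comp (mfderiv 𝓘(ℝ, E) 𝓘(ℝ, E) F x))

end PoissonStructure

/-- The space of coordinate values `(p, q, z)`, of dimension `2r + s`. -/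
abbrev PQZ (r s : ℕ) : Type := (Fin r → ℝ) × (Fin r → ℝ) × (Fin s → ℝ)

/-- A system of smooth local coordinates `(p_1, …, p_r, q_1, …, q_r, z_1, …, z_s)` on the open set
`φ.source`: a diffeomorphism of it onto the open set `φ.target` of `ℝ^(2r+s)`. -/
structure IsSmoothCoordinates {E M : Type*} [NormedAddCommGroup E] [NormedSpace ℝ E]
    [TopologicalSpace M] [ChartedSpace E M] {r s : ℕ}
    (φ : OpenPartialHomeomorph M (PQZ r s)) : Prop where
  contMDiffOn : ContMDiffOn 𝓘(ℝ, E) 𝓘(ℝ, PQZ r s) ∞ φ φ.source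
  contMDiffOn_symm : ContMDiffOn 𝓘(ℝ, PQZ r s) 𝓘(ℝ, E) ∞ φ.symm φ.target

section CoordinateVectors

variable {E M : Type*} [NormedAddCommGroup E] [NormedSpace ℝ E]
  [TopologicalSpace M] [ChartedSpace E M] {r s : ℕ}

/-- The tangent vector at `x` whose components in the coordinates `φ` are given by `v`. -/
noncomputable def coordVector (φ : OpenPartialHomeomorph M (PQZ r s)) (v : PQZ r s) (x : M) :
    TangentSpace 𝓘(ℝ, E) x :=
  mfderiv 𝓘(ℝ, PQZ r s) 𝓘(ℝ, E) φ.symm (φ x) v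

/-- The coordinate vector field `∂/∂p_i`. -/
noncomputable def partialP (φ : OpenPartialHomeomorph M (PQZ r s)) (i : Fin r) (x : M) :
    TangentSpace 𝓘(ℝ, E) x :=
  coordVector φ (Pi.single i 1, 0, 0) x

/-- The coordinate vector field `∂/∂q_i`. -/
noncomputable def partialQ (φ : OpenPartialHomeomorph M (PQZ r s)) (i : Fin r) (x : M) :
    TangentSpace 𝓘(ℝ, E) x :=
  coordVector φ (0, Pi.single i 1, 0) x

/-- The coordinate vector field `∂/∂z_j`. -/
noncomputable def partialZ (φ : OpenPartialHomeomorph M (PQZ r s)) (j : Fin s) (x : M) :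
    TangentSpace 𝓘(ℝ, E) x :=
  coordVector φ (0, 0, Pi.single j 1) x

/-- `(u ∧ v)(α, β) = α(u) β(v) - α(v) β(u)` for tangent vectors `u, v` at `x`. -/
noncomputable def wedge {x : M} (u v : TangentSpace 𝓘(ℝ, E) x)
    (α β : TangentSpace 𝓘(ℝ, E) x →L[ℝ] ℝ) : ℝ :=
  α u * β v - α v * β u

end CoordinateVectors

/-! This is the Carathéodory–Jacobi–Lie theorem combined with Weinstein's splitting, made
equivariant by averaging over the compact group.

Everything rests on one extension principle, `exists_bracket_eq_const`. If functions f_i have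
constant mutual brackets, the Jacobi identity makes their Hamiltonian fields commute. If these
fields are also independent at m, their joint flow gives flow-box coordinates in which each field is
a constant basis vector. Functions that are linear in such coordinates have constant brackets with
all f_i, and their differential at m can be any prescribed covector. The joint flow comes from the
inverse function theorem applied to the integral equation on C([0,1], E).

Brackets with invariant functions survive averaging, because G preserves Π. Averaging therefore
turns the extension principle into an invariant one, and the conjugates q_i are adjoined one by one
(`exists_invariant_conjugate`). The covectors at m annihilating all X_{p_i} and X_{q_i} give s
further functions commuting with p and q. G acts linearly on their differentials through matrices
A(g), and Bochner's average ∫ A(g) z(g⁻¹x) dg makes them equivariant without changing those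
differentials (`exists_equivariant_transverse`).

The differentials of p, q, z are independent at m, so these functions form a chart, which is cut
down to an invariant box. By Jacobi, {z_i, z_j} commutes with p and q. Since X_{p_i} = ∂/∂q_i and
X_{q_i} = −∂/∂p_i, its p- and q-derivatives vanish and it depends on z alone
(`IsSplittingChart.bracket_z_eq`). The fields X_{p_i}, X_{q_i} already contribute rank 2r, so the
rank exceeds 2r exactly when some {z_i, z_j} is nonzero. -/

open Filter Set MeasureTheory

universe u

/-! ### Inverse function theorem and cut-off of smooth germs -/

/-- Inverse function theorem for maps which are smooth near a point. -/
theorem exists_openPartialHomeomorph_of_contDiffAt {E F : Type*} [NormedAddCommGroup E]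
    [NormedSpace ℝ E] [CompleteSpace E] [NormedAddCommGroup F] [NormedSpace ℝ F]
    {f : E → F} {f' : E ≃L[ℝ] F} {a : E} (hf : ∀ᶠ x in 𝓝 a, ContDiffAt ℝ ∞ f x)
    (hf' : HasFDerivAt f (f' : E →L[ℝ] F) a) :
    ∃ e : OpenPartialHomeomorph E F, a ∈ e.source ∧ ⇑e = f ∧
      (∀ x ∈ e.source, ContDiffAt ℝ ∞ f x) ∧ ∀ y ∈ e.target, ContDiffAt ℝ ∞ e.symm y := by
  have h0 : ContDiffAt ℝ ∞ f a := hf.self_of_nhds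
  have hn : (∞ : WithTop ℕ∞) ≠ 0 := by simp
  let e₀ := h0.toOpenPartialHomeomorph f hf' hn
  have hc : ContinuousAt (fderiv ℝ f) a :=
    (h0.fderiv_right (m := 0) (by simp)).continuousAt
  -- Invertibility of the derivative is an open condition. Shrinking the source to points where it
  -- holds makes the inverse smooth on the whole target, not only at `f a`.
  have hinv : ∀ᶠ x in 𝓝 a, ∃ g : E ≃L[ℝ] F, (g : E →L[ℝ] F) = fderiv ℝ f x := by
    have := hc.tendsto.eventually_mem (by
      rw [hf'.fderiv]; exact ContinuousLinearEquiv.nhds f')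
    exact this
  obtain ⟨W, hW, hWo, haW⟩ := eventually_nhds_iff.1 (hf.and hinv)
  refine ⟨e₀.restrOpen W hWo, ⟨h0.mem_toOpenPartialHomeomorph_source hf' hn, haW⟩, rfl,
    fun x hx => (hW x hx.2).1, fun y hy => ?_⟩
  have hx := (e₀.restrOpen W hWo).map_target hy
  obtain ⟨g, hg⟩ := (hW _ hx.2).2
  have hd := (hW _ hx.2).1
  refine (e₀.restrOpen W hWo).contDiffAt_symm (f₀' := g) hy ?_ hd
  rw [hg]
  exact (hd.differentiableAt hn).hasFDerivAt

/-- A vector-valued function which is smooth near a point agrees near that point with a globally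
smooth one. -/
theorem exists_contDiff_eventuallyEq {E F : Type*} [NormedAddCommGroup E]
    [NormedSpace ℝ E] [FiniteDimensional ℝ E] [NormedAddCommGroup F] [NormedSpace ℝ F]
    {f : E → F} {a : E} (hf : ∀ᶠ x in 𝓝 a, ContDiffAt ℝ ∞ f x) :
    ∃ g : E → F, ContDiff ℝ ∞ g ∧ g =ᶠ[𝓝 a] f := by
  obtain ⟨ε, hε, hb⟩ := Metric.eventually_nhds_iff_ball.1 hf
  -- The support is the closed ball of radius `ε / 2`, inside the ball on which `f` is smooth; off
  -- the support the product vanishes locally.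
  let b : ContDiffBump a := ⟨ε / 3, ε / 2, by positivity, by linarith⟩
  refine ⟨fun x => b x • f x, contDiff_iff_contDiffAt.2 fun x => ?_, ?_⟩
  · by_cases hx : x ∈ Metric.ball a ε
    · exact b.contDiffAt.smul (hb x hx)
    · have hx' : x ∉ tsupport b := by
        rw [b.tsupport_eq]
        intro h
        apply hx
        simp only [Metric.mem_closedBall, Metric.mem_ball] at h ⊢
        have : b.rOut = ε / 2 := rfl
        linarith
      have : (fun x => b x • f x) =ᶠ[𝓝 x] fun _ => 0 := by
        filter_upwards [notMem_tsupport_iff_eventuallyEq.1 hx'] with y hy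
        simp [hy]
      exact contDiffAt_const.congr_of_eventuallyEq this
  · filter_upwards [b.eventuallyEq_one] with x hx
    simp [hx]

/-! ### Superposition operators on spaces of continuous paths -/

section PathSpace

variable {I : Type*} [TopologicalSpace I] [CompactSpace I]

/-- Pointwise application of a path of operators to a path of vectors. -/
noncomputable def pathApply (I : Type*) [TopologicalSpace I] [CompactSpace I]
    (E F : Type*) [NormedAddCommGroup E] [NormedSpace ℝ E]
    [NormedAddCommGroup F] [NormedSpace ℝ F] :
    C(I, E →L[ℝ] F) →L[ℝ] C(I, E) →L[ℝ] C(I, F) :=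
  LinearMap.mkContinuous₂
    (LinearMap.mk₂ ℝ (fun (A : C(I, E →L[ℝ] F)) (v : C(I, E)) =>
      (⟨fun s => A s (v s), A.continuous.clm_apply v.continuous⟩ : C(I, F)))
      (by intros; ext; simp) (by intros; ext; simp) (by intros; ext; simp)
      (by intros; ext; simp)) 1 fun A v => by
    rw [ContinuousMap.norm_le _ (by positivity)]
    intro s
    rw [one_mul]
    exact (ContinuousLinearMap.le_opNorm _ _).trans
      (mul_le_mul (A.norm_coe_le_norm s) (v.norm_coe_le_norm s) (norm_nonneg _) (by positivity))

@[simp] theorem pathApply_apply {E F : Type*} [NormedAddCommGroup E] [NormedSpace ℝ E]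
    [NormedAddCommGroup F] [NormedSpace ℝ F] (A : C(I, E →L[ℝ] F)) (v : C(I, E)) (s : I) :
    pathApply I E F A v s = A s (v s) := rfl

theorem norm_pathApply_le {E F : Type*} [NormedAddCommGroup E] [NormedSpace ℝ E]
    [NormedAddCommGroup F] [NormedSpace ℝ F] (A : C(I, E →L[ℝ] F)) (v : C(I, E)) :
    ‖pathApply I E F A v‖ ≤ ‖A‖ * ‖v‖ := by
  rw [ContinuousMap.norm_le _ (by positivity)]
  intro s
  exact (ContinuousLinearMap.le_opNorm _ _).trans
    (mul_le_mul (A.norm_coe_le_norm s) (v.norm_coe_le_norm s) (norm_nonneg _) (by positivity))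

/-- The derivative of the superposition operator `γ ↦ X ∘ γ` on continuous paths. -/
theorem hasFDerivAt_postcomp {E F : Type*} [NormedAddCommGroup E] [NormedSpace ℝ E]
    [NormedAddCommGroup F] [NormedSpace ℝ F] (X : C(E, F)) (X' : C(E, E →L[ℝ] F))
    (hX : ∀ x, HasFDerivAt X (X' x) x) (γ : C(I, E)) :
    HasFDerivAt (fun γ : C(I, E) => X.comp γ) (pathApply I E F (X'.comp γ)) γ := by
  rw [hasFDerivAt_iff_isLittleO_nhds_zero, Asymptotics.isLittleO_iff]
  intro ε hε
  -- Shifting `γ` by constant vectors, continuity in the sup norm at `w = 0` gives one `δ` valid for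
  -- all parameters `s` at once. The mean value estimate needs this uniformity.
  have hcont : Continuous fun w : E => X'.comp (γ + ContinuousMap.const I w) :=
    (ContinuousMap.continuous_postcomp X').comp
      (continuous_const.add ContinuousMap.continuous_const')
  obtain ⟨δ, hδ, h⟩ :=
    (Metric.continuous_iff (α := E) (β := C(I, E →L[ℝ] F))).1 hcont 0 ε hε
  filter_upwards [Metric.ball_mem_nhds (0 : C(I, E)) hδ] with v hv
  rw [ContinuousMap.norm_le _ (by positivity)]
  intro s
  have hvs : ‖v s‖ ≤ ‖v‖ := v.norm_coe_le_norm s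
  have hv' : ‖v‖ < δ := by simpa using hv
  have key : ∀ z ∈ Metric.closedBall (γ s) ‖v‖, ‖X' z - X' (γ s)‖ ≤ ε := by
    intro z hz
    have hz' : ‖z - γ s‖ ≤ ‖v‖ := by simpa [dist_eq_norm] using hz
    have h1 := h (z - γ s) (by simpa [dist_eq_norm] using hz'.trans_lt hv')
    have h2 := (ContinuousMap.dist_apply_le_dist s).trans h1.le
    simpa [dist_eq_norm] using h2
  have hmv := (convex_closedBall (γ s) ‖v‖).norm_image_sub_le_of_norm_hasFDerivWithin_le'
    (f := X) (f' := fun z => X' z) (φ := X' (γ s)) (C := ε)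
    (fun z _ => (hX z).hasFDerivWithinAt) key
    (Metric.mem_closedBall_self (norm_nonneg _)) (y := γ s + v s) (by simpa [dist_eq_norm] using hvs)
  simp only [add_sub_cancel_left] at hmv
  refine le_trans ?_ (hmv.trans (by gcongr))
  simp

/-- Induction on the order: the derivative of γ ↦ X ∘ γ is the superposition operator of X' followed
by the continuous linear map `pathApply`. The target changes from `F` to `E →L[ℝ] F`, so `F` is
quantified inside the induction and shares a universe with `E`. -/
theorem contDiff_postcomp_nat (n : ℕ) {E : Type u} [NormedAddCommGroup E] [NormedSpace ℝ E] :
    ∀ {F : Type u} [NormedAddCommGroup F] [NormedSpace ℝ F] (X : C(E, F)),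
      ContDiff ℝ n X → ContDiff ℝ n (fun γ : C(I, E) => X.comp γ) := by
  induction n with
  | zero =>
    intro F _ _ X _
    exact contDiff_zero.2 (ContinuousMap.continuous_postcomp X)
  | succ n ih =>
    intro F _ _ X hX
    obtain ⟨X', hX', hd⟩ := contDiff_succ_iff_hasFDerivAt.1 hX
    refine contDiff_succ_iff_hasFDerivAt.2
      ⟨fun γ => pathApply I E F ((⟨X', hX'.continuous⟩ : C(E, E →L[ℝ] F)).comp γ), ?_,
        fun γ => hasFDerivAt_postcomp X _ hd γ⟩
    exact (pathApply I E F).contDiff.comp (ih ⟨X', hX'.continuous⟩ hX')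

/-- The superposition operator of a smooth map is smooth. -/
theorem contDiff_postcomp {E F : Type u} [NormedAddCommGroup E] [NormedSpace ℝ E]
    [NormedAddCommGroup F] [NormedSpace ℝ F] (X : C(E, F)) (hX : ContDiff ℝ ∞ X) :
    ContDiff ℝ ∞ (fun γ : C(I, E) => X.comp γ) :=
  contDiff_infty.2 fun n => contDiff_postcomp_nat n X (hX.of_le (by exact_mod_cast le_top))

end PathSpace

/-! ### The integral equation and the joint flow of commuting fields -/

/-- The primitive vanishing at `0` of a continuous path on the unit interval. -/
noncomputable def pathIntegral (E : Type*) [NormedAddCommGroup E] [NormedSpace ℝ E] :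
    C(unitInterval, E) →L[ℝ] C(unitInterval, E) :=
  LinearMap.mkContinuous
    { toFun := fun v => ⟨fun s => ∫ τ in (0 : ℝ)..s, v (projIcc 0 1 zero_le_one τ),
        (intervalIntegral.continuous_primitive (fun _ _ =>
          (v.continuous.comp continuous_projIcc).intervalIntegrable _ _) 0).comp
          continuous_subtype_val⟩
      map_add' := fun v w => by
        ext s
        exact intervalIntegral.integral_add
          ((v.continuous.comp continuous_projIcc).intervalIntegrable _ _)
          ((w.continuous.comp continuous_projIcc).intervalIntegrable _ _)
      map_smul' := fun c v => by
        ext s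
        exact intervalIntegral.integral_smul _ _ } 1 fun v => by
    rw [ContinuousMap.norm_le _ (by positivity)]
    intro s
    have := intervalIntegral.norm_integral_le_of_norm_le_const (a := (0 : ℝ)) (b := s)
      (f := fun τ => v (projIcc 0 1 zero_le_one τ)) (C := ‖v‖)
      (fun τ _ => v.norm_coe_le_norm _)
    refine this.trans ?_
    rw [sub_zero, abs_of_nonneg s.2.1, one_mul]
    exact mul_le_of_le_one_right (norm_nonneg _) s.2.2


theorem pathIntegral_apply {E : Type*} [NormedAddCommGroup E] [NormedSpace ℝ E] (v : C(unitInterval, E))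
    (s : unitInterval) : pathIntegral E v s = ∫ τ in (0 : ℝ)..s, v (projIcc 0 1 zero_le_one τ) := rfl


theorem norm_pathIntegral_le {E : Type*} [NormedAddCommGroup E] [NormedSpace ℝ E]
    (v : C(unitInterval, E)) : ‖pathIntegral E v‖ ≤ ‖v‖ := by
  have := (LinearMap.mkContinuous_norm_le _ zero_le_one _ : ‖pathIntegral E‖ ≤ 1)
  simpa using (pathIntegral E).le_of_opNorm_le this v

section Flow

variable {E : Type*} [NormedAddCommGroup E] [NormedSpace ℝ E] {ι : Type*} [Fintype ι]

/-- The constant paths on the unit interval, as a continuous linear map. -/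
noncomputable def constPath (E : Type*) [NormedAddCommGroup E] [NormedSpace ℝ E] :
    E →L[ℝ] C(unitInterval, E) where
  toFun := ContinuousMap.const _
  map_add' _ _ := rfl
  map_smul' _ _ := rfl
  cont := ContinuousMap.continuous_const'

@[simp] theorem constPath_apply (x : E) (s : unitInterval) : constPath E x s = x := rfl

/-- The derivative of the right-hand side of the integral equation of the vector field
`∑ i, t i • X i` with respect to the times `t`, the initial value and the path. -/
theorem hasFDerivAt_integral_operator (X : ι → C(E, E)) (X' : ι → C(E, E →L[ℝ] E))
    (hX : ∀ i x, HasFDerivAt (X i) (X' i x) x) (u : ((ι → ℝ) × E) × C(unitInterval, E)) :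
    HasFDerivAt (fun u : ((ι → ℝ) × E) × C(unitInterval, E) =>
      constPath E u.1.2 + pathIntegral E (∑ i, u.1.1 i • (X i).comp u.2))
      ((constPath E).comp ((ContinuousLinearMap.snd ℝ _ _).comp (ContinuousLinearMap.fst ℝ _ _)) +
        (pathIntegral E).comp (∑ i, (u.1.1 i • (pathApply _ E E ((X' i).comp u.2)).comp
            (ContinuousLinearMap.snd ℝ _ _) +
          (((ContinuousLinearMap.proj i).comp (ContinuousLinearMap.fst ℝ (ι → ℝ) E)).comp
            (ContinuousLinearMap.fst ℝ _ _)).smulRight ((X i).comp u.2)))) u := by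
  refine HasFDerivAt.add (ContinuousLinearMap.hasFDerivAt
    ((constPath E).comp ((ContinuousLinearMap.snd ℝ (ι → ℝ) E).comp
      (ContinuousLinearMap.fst ℝ ((ι → ℝ) × E) C(unitInterval, E))))) ?_
  refine (pathIntegral E).hasFDerivAt.comp u ?_
  refine HasFDerivAt.fun_sum fun i _ => ?_
  have h1 : HasFDerivAt (fun u : ((ι → ℝ) × E) × C(unitInterval, E) => u.1.1 i)
      (((ContinuousLinearMap.proj i).comp (ContinuousLinearMap.fst ℝ (ι → ℝ) E)).comp
        (ContinuousLinearMap.fst ℝ ((ι → ℝ) × E) C(unitInterval, E))) u :=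
    (((ContinuousLinearMap.proj (R := ℝ) (φ := fun _ : ι => ℝ) i).comp
      (ContinuousLinearMap.fst ℝ (ι → ℝ) E)).comp
        (ContinuousLinearMap.fst ℝ ((ι → ℝ) × E) C(unitInterval, E))).hasFDerivAt
  have h2 : HasFDerivAt (fun u : ((ι → ℝ) × E) × C(unitInterval, E) => (X i).comp u.2)
      ((pathApply _ E E ((X' i).comp u.2)).comp (ContinuousLinearMap.snd ℝ _ _)) u :=
    (hasFDerivAt_postcomp (X i) (X' i) (hX i) u.2).comp u
      (ContinuousLinearMap.snd ℝ ((ι → ℝ) × E) C(unitInterval, E)).hasFDerivAt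
  exact h1.smul h2

/-- Smooth dependence on times and initial values of the solutions of the integral equation of the
vector field `∑ i, t i • X i`, for small `t`. -/
theorem exists_smooth_path_of_integral_equation [CompleteSpace E] (X : ι → C(E, E))
    (hX : ∀ i, ContDiff ℝ ∞ (X i)) (x₀ : E) :
    ∃ Γ : (ι → ℝ) × E → C(unitInterval, E),
      (∀ᶠ u in 𝓝 ((0 : ι → ℝ), x₀), ContDiffAt ℝ ∞ Γ u) ∧ Γ (0, x₀) = constPath E x₀ ∧
      ∀ᶠ u in 𝓝 ((0 : ι → ℝ), x₀),
        Γ u = constPath E u.2 + pathIntegral E (∑ i, u.1 i • (X i).comp (Γ u)) := by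
  let X' : ι → C(E, E →L[ℝ] E) := fun i =>
    ⟨fderiv ℝ (X i), (hX i).continuous_fderiv (by simp)⟩
  have hX' : ∀ i x, HasFDerivAt (X i) (X' i x) x := fun i x =>
    (((hX i).differentiable (by simp)) x).hasFDerivAt
  let B : ((ι → ℝ) × E) × C(unitInterval, E) → C(unitInterval, E) := fun u =>
    constPath E u.1.2 + pathIntegral E (∑ i, u.1.1 i • (X i).comp u.2)
  -- Solutions of the integral equation are the zeros of the second component of `H`, so `Γ u` is
  -- read off from the local inverse at `(u, 0)`.
  let H : ((ι → ℝ) × E) × C(unitInterval, E) → ((ι → ℝ) × E) × C(unitInterval, E) := fun u =>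
    (u.1, u.2 - B u)
  let a : ((ι → ℝ) × E) × C(unitInterval, E) := ((0, x₀), constPath E x₀)
  have hB : ContDiff ℝ ∞ B := by
    refine ((constPath E).contDiff.comp (contDiff_snd.comp contDiff_fst)).add
      ((pathIntegral E).contDiff.comp (ContDiff.sum fun i _ => ?_))
    have h1 : ContDiff ℝ ∞ (fun u : ((ι → ℝ) × E) × C(unitInterval, E) => u.1.1 i) :=
      (contDiff_apply ℝ ℝ i).comp (contDiff_fst.comp contDiff_fst)
    have h2 : ContDiff ℝ ∞ (fun u : ((ι → ℝ) × E) × C(unitInterval, E) => (X i).comp u.2) :=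
      (contDiff_postcomp (X i) (hX i)).comp contDiff_snd
    exact h1.smul h2
  have hH : ContDiff ℝ ∞ H := contDiff_fst.prodMk (contDiff_snd.sub hB)
  have hBa := hasFDerivAt_integral_operator X X' hX' a
  let L : ((ι → ℝ) × E) →L[ℝ] C(unitInterval, E) :=
    (constPath E).comp (ContinuousLinearMap.snd ℝ _ _) +
      (pathIntegral E).comp (∑ i, ((ContinuousLinearMap.proj i).comp
        (ContinuousLinearMap.fst ℝ (ι → ℝ) E)).smulRight ((X i).comp (constPath E x₀)))
  -- At times `0` the derivative of `B` in the path direction vanishes. The derivative of `H` is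
  -- therefore the shear (w, v) ↦ (w, v − L w), which is invertible.
  have hHa : HasFDerivAt H (((ContinuousLinearEquiv.refl ℝ ((ι → ℝ) × E)).skewProd
      (ContinuousLinearEquiv.refl ℝ C(unitInterval, E)) (-L) : _ ≃L[ℝ] _) :
      ((ι → ℝ) × E) × C(unitInterval, E) →L[ℝ] ((ι → ℝ) × E) × C(unitInterval, E)) a := by
    have h := (hasFDerivAt_fst (𝕜 := ℝ) (p := a)).prodMk
      ((hasFDerivAt_snd (𝕜 := ℝ) (p := a)).sub hBa)
    refine h.congr_fderiv (Eq.symm ?_)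
    refine ContinuousLinearMap.ext fun w => ?_
    refine Prod.ext (by simp) ?_
    simp [L, a, sub_eq_add_neg]
  obtain ⟨e, hae, he, -, hes⟩ := exists_openPartialHomeomorph_of_contDiffAt
    (Eventually.of_forall fun x => hH.contDiffAt) hHa
  have hea : e a = ((0, x₀), 0) := by
    rw [he]
    simp [H, B, a]
  have hmem : ((0, x₀), 0) ∈ e.target := hea ▸ e.map_source hae
  have hev : ∀ᶠ u : (ι → ℝ) × E in 𝓝 (0, x₀), (u, (0 : C(unitInterval, E))) ∈ e.target :=
    (Continuous.prodMk continuous_id continuous_const).continuousAt.eventually_mem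
      (e.open_target.mem_nhds hmem)
  refine ⟨fun u => (e.symm (u, 0)).2, ?_, ?_, ?_⟩
  · filter_upwards [hev] with u hu
    exact (ContDiffAt.comp (g := e.symm) (f := fun u => (u, (0 : C(unitInterval, E)))) u (hes _ hu)
      (contDiffAt_id.prodMk contDiffAt_const)).snd
  · change (e.symm ((0, x₀), 0)).2 = _
    rw [← hea, e.left_inv hae]
  · filter_upwards [hev] with u hu
    have h := e.right_inv hu
    rw [he] at h
    have h1 : (e.symm (u, 0)).1 = u := congrArg Prod.fst h
    have h2 : (e.symm (u, 0)).2 - B (e.symm (u, 0)) = 0 := congrArg Prod.snd h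
    have h3 := sub_eq_zero.1 h2
    simp only [B, h1] at h3
    exact h3

/-- Along a solution `γ` of the integral equation of `∑ i, u i • X i`, where the `X i` commute,
the path `s ↦ s • ∑ j, τ j • X j (γ s)` solves the linearized integral equation. -/
theorem linearized_integral_equation [CompleteSpace E] (X : ι → C(E, E))
    (X' : ι → C(E, E →L[ℝ] E)) (hX : ∀ i x, HasFDerivAt (X i) (X' i x) x) (u : ι → ℝ) (x : E)
    (γ : C(unitInterval, E))
    (hγ : γ = constPath E x + pathIntegral E (∑ i, u i • (X i).comp γ))
    (hcomm : ∀ s i j, X' i (γ s) (X j (γ s)) = X' j (γ s) (X i (γ s))) (τ : ι → ℝ)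
    (V : C(unitInterval, E)) (hV : ∀ s, V s = (s : ℝ) • ∑ j, τ j • X j (γ s)) :
    V = pathIntegral E
      (∑ j, (u j • pathApply _ E E ((X' j).comp γ) V + τ j • (X j).comp γ)) := by
  -- Clamping time to [0, 1] extends the solution to a differentiable curve `c` on the whole line,
  -- which avoids one-sided derivatives.
  let pr : ℝ → unitInterval := projIcc 0 1 zero_le_one
  let h : ℝ → E := fun σ' => ∑ i, u i • X i (γ (pr σ'))
  have hpr : Continuous pr := continuous_projIcc
  have hh : Continuous h := by fun_prop
  let c : ℝ → E := fun t => x + ∫ w in (0 : ℝ)..t, h w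
  have hc : ∀ t, HasDerivAt c (h t) t := fun t => by
    have := intervalIntegral.integral_hasDerivAt_right (hh.intervalIntegrable 0 t)
      (hh.stronglyMeasurableAtFilter _ _) hh.continuousAt
    exact this.const_add x
  have hcγ : ∀ s : unitInterval, c s = γ s := fun s => by
    have := congrArg (fun g : C(unitInterval, E) => g s) hγ
    simp only [ContinuousMap.add_apply, constPath_apply, pathIntegral_apply] at this
    rw [this]
    simp [c, h, pr]
  -- The derivative of `k` contains terms DX_j(X_i), where the linearized equation has DX_i(X_j);
  -- `hcomm` identifies the two.
  let k : ℝ → E := fun t => t • ∑ j, τ j • X j (c t)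
  have hk : ∀ t, HasDerivAt k
      (t • (∑ j, τ j • X' j (c t) (h t)) + (1 : ℝ) • ∑ j, τ j • X j (c t)) t := fun t => by
    refine (hasDerivAt_id t).smul (HasDerivAt.fun_sum fun j _ => ?_)
    exact ((hX j (c t)).comp_hasDerivAt t (hc t)).const_smul (τ j)
  have hcc : Continuous c := continuous_iff_continuousAt.2 fun t => (hc t).continuousAt
  ext s
  rw [pathIntegral_apply, hV]
  have hint := intervalIntegral.integral_eq_sub_of_hasDerivAt (a := (0 : ℝ)) (b := s)
    (f := k) (fun t _ => hk t) (by
      refine Continuous.intervalIntegrable ?_ _ _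
      have : ∀ j, Continuous fun t => X' j (c t) (h t) := fun j =>
        ((X' j).continuous.comp hcc).clm_apply hh
      fun_prop)
  have hk0 : k s - k 0 = (s : ℝ) • ∑ j, τ j • X j (γ s) := by
    simp [k, hcγ]
  rw [← hk0, ← hint]
  refine intervalIntegral.integral_congr fun t ht => ?_
  rw [uIcc_of_le s.2.1] at ht
  have ht1 : t ∈ Icc (0 : ℝ) 1 := ⟨ht.1, ht.2.trans s.2.2⟩
  have hprt : projIcc 0 1 zero_le_one t = (⟨t, ht1⟩ : unitInterval) := projIcc_of_mem _ ht1
  have hct : c t = γ ⟨t, ht1⟩ := hcγ ⟨t, ht1⟩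
  simp only [hprt, hct, ContinuousMap.coe_sum, Finset.sum_apply, ContinuousMap.add_apply,
    ContinuousMap.smul_apply, pathApply_apply, ContinuousMap.comp_apply, hV, h, pr, map_sum,
    map_smul, one_smul, Finset.sum_add_distrib]
  congr 1
  rw [Finset.smul_sum]
  simp_rw [Finset.smul_sum]
  rw [Finset.sum_comm]
  refine Finset.sum_congr rfl fun i _ => Finset.sum_congr rfl fun j _ => ?_
  rw [hcomm]
  simp only [smul_smul]
  congr 1
  ring

/-- Commuting smooth vector fields have a smooth joint local flow. -/
theorem exists_joint_flow [CompleteSpace E] (X : ι → E → E) (hX : ∀ i, ContDiff ℝ ∞ (X i)) (x₀ : E)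
    (hcomm : ∀ᶠ x in 𝓝 x₀, ∀ i j, fderiv ℝ (X i) x (X j x) = fderiv ℝ (X j) x (X i x)) :
    ∃ ψ : (ι → ℝ) × E → E, (∀ᶠ u in 𝓝 ((0 : ι → ℝ), x₀), ContDiffAt ℝ ∞ ψ u) ∧
      (∀ᶠ x in 𝓝 x₀, ψ (0, x) = x) ∧
      ∀ᶠ u in 𝓝 ((0 : ι → ℝ), x₀), ∀ τ : ι → ℝ, fderiv ℝ ψ u (τ, 0) = ∑ i, τ i • X i (ψ u) := by
  let Xc : ι → C(E, E) := fun i => ⟨X i, (hX i).continuous⟩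
  let X' : ι → C(E, E →L[ℝ] E) := fun i =>
    ⟨fderiv ℝ (X i), (hX i).continuous_fderiv (by simp)⟩
  have hX' : ∀ i x, HasFDerivAt (Xc i) (X' i x) x := fun i x =>
    (((hX i).differentiable (by simp)) x).hasFDerivAt
  obtain ⟨Γ, hsm, h0, heq⟩ := exists_smooth_path_of_integral_equation Xc hX x₀
  -- The joint flow for times t is the time-one map of ∑ t_i X_i.
  let ev : C(unitInterval, E) →L[ℝ] E := ContinuousMap.evalCLM ℝ 1
  have hΓc : ContinuousAt Γ (0, x₀) := hsm.self_of_nhds.continuousAt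
  refine ⟨fun u => ev (Γ u), ?_, ?_, ?_⟩
  · filter_upwards [hsm] with u hu
    exact ev.contDiff.contDiffAt.comp u hu
  · have hcont : ContinuousAt (fun x : E => ((0 : ι → ℝ), x)) x₀ := by fun_prop
    filter_upwards [hcont.eventually heq] with x hx
    rw [hx]
    simp [ev]
  · obtain ⟨ε, hε, hball⟩ := Metric.eventually_nhds_iff_ball.1 hcomm
    have hnear : ∀ᶠ u in 𝓝 ((0 : ι → ℝ), x₀), ∀ s, Γ u s ∈ Metric.ball x₀ ε := by
      filter_upwards [hΓc.eventually_mem (Metric.ball_mem_nhds _ hε)] with u hu s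
      rw [h0] at hu
      exact (ContinuousMap.dist_apply_le_dist (f := Γ u) (g := constPath E x₀) s).trans_lt hu
    -- For small times the linearized integral operator is a strict contraction, so its equation has
    -- at most one solution. This forces the derivative `W` to equal the explicit solution `V`.
    have hsmall : ∀ᶠ u in 𝓝 ((0 : ι → ℝ), x₀), ∑ j, ‖u.1 j‖ * ‖(X' j).comp (Γ u)‖ < 1 := by
      have hcont : ContinuousAt (fun u : (ι → ℝ) × E => ∑ j, ‖u.1 j‖ * ‖(X' j).comp (Γ u)‖)
          (0, x₀) := by
        refine tendsto_finsetSum _ fun j _ => ?_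
        refine Tendsto.mul (Continuous.tendsto (by fun_prop) _) ?_
        exact ((continuous_norm (E := C(unitInterval, E →L[ℝ] E))).tendsto _).comp <|
          ((ContinuousMap.continuous_postcomp (X' j)).tendsto _).comp hΓc
      refine hcont.eventually_lt_const ?_
      simp
    filter_upwards [hsm, heq.eventually_nhds, hnear, hsmall] with u hu hequ hnu hsu τ
    have hd : HasFDerivAt Γ (fderiv ℝ Γ u) u := (hu.differentiableAt (by simp)).hasFDerivAt
    have hd1 := (hasFDerivAt_integral_operator Xc X' hX' (u, Γ u)).comp u
      ((hasFDerivAt_id u).prodMk hd)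
    have hd2 := hd1.congr_of_eventuallyEq (f₁ := Γ) (hequ.mono fun v hv => hv)
    set W := fderiv ℝ Γ u (τ, 0) with hW
    have hWeq : W = pathIntegral E
        (∑ j, (u.1 j • pathApply _ E E ((X' j).comp (Γ u)) W + τ j • (Xc j).comp (Γ u))) := by
      have := congrArg (fun A : ((ι → ℝ) × E) →L[ℝ] C(unitInterval, E) => A (τ, 0))
        (hd.unique hd2)
      simpa [← hW, _root_.sum_apply] using this
    let V : C(unitInterval, E) := ⟨fun s => (s : ℝ) • ∑ j, τ j • Xc j (Γ u s), by fun_prop⟩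
    have hVeq := linearized_integral_equation Xc X' hX' u.1 u.2 (Γ u) hequ.self_of_nhds
      (fun s i j => hball _ (hnu s) i j) τ V (fun s => rfl)
    have hWV : W = V := by
      have hdiff : W - V = pathIntegral E
          (∑ j, u.1 j • pathApply _ E E ((X' j).comp (Γ u)) (W - V)) := by
        conv_lhs => rw [hWeq, hVeq]
        rw [← map_sub, ← Finset.sum_sub_distrib]
        congr 1
        refine Finset.sum_congr rfl fun j _ => ?_
        rw [map_sub, smul_sub]
        abel
      have hle : ‖W - V‖ ≤ (∑ j, ‖u.1 j‖ * ‖(X' j).comp (Γ u)‖) * ‖W - V‖ := by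
        conv_lhs => rw [hdiff]
        refine (norm_pathIntegral_le _).trans ((norm_sum_le _ _).trans ?_)
        rw [Finset.sum_mul]
        refine Finset.sum_le_sum fun j _ => ?_
        rw [norm_smul, mul_assoc]
        exact mul_le_mul_of_nonneg_left (norm_pathApply_le _ _) (norm_nonneg _)
      have hz : ‖W - V‖ = 0 := by
        by_contra hne
        have hpos : 0 < ‖W - V‖ := lt_of_le_of_ne (norm_nonneg _) (Ne.symm hne)
        nlinarith
      exact sub_eq_zero.1 (norm_eq_zero.1 hz)
    have hfd : fderiv ℝ (fun u => ev (Γ u)) u = ev.comp (fderiv ℝ Γ u) :=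
      (ev.hasFDerivAt.comp u hd).fderiv
    rw [hfd]
    change ev W = _
    rw [hWV]
    simp [ev, V, Xc]

end Flow

/-! ### Flow-box coordinates -/

/-- Given commuting smooth vector fields which are linearly independent at a point, every covector
at that point is the differential of a function with constant derivatives along the fields. -/
theorem exists_contDiffAt_fderiv_commuting_const {E : Type*} [NormedAddCommGroup E]
    [NormedSpace ℝ E] [FiniteDimensional ℝ E] {ι : Type*} [Fintype ι] (X : ι → E → E) (x₀ : E)
    (hX : ∀ i, ∀ᶠ x in 𝓝 x₀, ContDiffAt ℝ ∞ (X i) x)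
    (hcomm : ∀ᶠ x in 𝓝 x₀, ∀ i j, fderiv ℝ (X i) x (X j x) = fderiv ℝ (X j) x (X i x))
    (hind : LinearIndependent ℝ fun i => X i x₀) (l : E →L[ℝ] ℝ) :
    ∃ f : E → ℝ, (∀ᶠ x in 𝓝 x₀, ContDiffAt ℝ ∞ f x) ∧ fderiv ℝ f x₀ = l ∧
      ∀ᶠ x in 𝓝 x₀, ∀ i, fderiv ℝ f x (X i x) = l (X i x₀) := by
  have := FiniteDimensional.complete ℝ E
  -- The joint flow is built for globally smooth fields; the cut-off leaves the fields unchanged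
  -- near `x₀`.
  choose Y hY hYX using fun i => exists_contDiff_eventuallyEq (hX i)
  have hYXall : ∀ᶠ x in 𝓝 x₀, ∀ i, Y i =ᶠ[𝓝 x] X i :=
    eventually_all.2 fun i => (hYX i).eventually_nhds
  have hY0 : ∀ i, Y i x₀ = X i x₀ := fun i => (hYX i).self_of_nhds
  obtain ⟨ψ, hψ, hψ0, hψX⟩ := exists_joint_flow Y hY x₀ (by
    filter_upwards [hcomm, hYXall] with x hx h i j
    rw [(h i).fderiv_eq, (h j).fderiv_eq, (h i).self_of_nhds, (h j).self_of_nhds, hx])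
  obtain ⟨S, hS⟩ := Submodule.exists_isCompl (Submodule.span ℝ (range fun i => X i x₀))
  -- Flow-box coordinates: start on the slice x₀ + S, with S a complement of the span of the fields
  -- at x₀, and flow for times t.
  let j : (ι → ℝ) × S → (ι → ℝ) × E := fun w => (w.1, x₀ + w.2)
  have hjd : ∀ w, HasFDerivAt j ((ContinuousLinearMap.id ℝ (ι → ℝ)).prodMap S.subtypeL) w :=
    fun w => (hasFDerivAt_fst.prodMk ((S.subtypeL.hasFDerivAt.comp w hasFDerivAt_snd).const_add x₀))
  have hjs : ContDiff ℝ ∞ j :=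
    contDiff_fst.prodMk (contDiff_const.add (S.subtypeL.contDiff.comp contDiff_snd))
  have hj0 : j 0 = (0, x₀) := by simp [j]
  have hjt : Tendsto j (𝓝 0) (𝓝 (0, x₀)) := hj0 ▸ hjs.continuous.continuousAt.tendsto
  have hψd : HasFDerivAt ψ (fderiv ℝ ψ (0, x₀)) (0, x₀) :=
    (hψ.self_of_nhds.differentiableAt (by simp)).hasFDerivAt
  have hψv : ∀ v : E, fderiv ℝ ψ (0, x₀) (0, v) = v := fun v => by
    have h1 : HasFDerivAt (fun x : E => ψ (0, x))
        ((fderiv ℝ ψ (0, x₀)).comp (ContinuousLinearMap.inr ℝ (ι → ℝ) E)) x₀ :=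
      hψd.comp x₀ ((hasFDerivAt_const _ _).prodMk (hasFDerivAt_id x₀))
    have h2 := h1.unique ((hasFDerivAt_id x₀).congr_of_eventuallyEq hψ0)
    simpa using congrArg (fun A : E →L[ℝ] E => A v) h2
  have hψx : ψ (0, x₀) = x₀ := hψ0.self_of_nhds
  let Ψ : (ι → ℝ) × S → E := ψ ∘ j
  let A : (ι → ℝ) × S →L[ℝ] E := (fderiv ℝ ψ (0, x₀)).comp
    ((ContinuousLinearMap.id ℝ (ι → ℝ)).prodMap S.subtypeL)
  have hA : ∀ w, A w = ∑ i, w.1 i • X i x₀ + w.2 := fun w => by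
    have h1 : (w.1, (w.2 : E)) = (w.1, 0) + (0, (w.2 : E)) := by simp
    change fderiv ℝ ψ (0, x₀) (w.1, (w.2 : E)) = _
    rw [h1, map_add, hψv, hψX.self_of_nhds]
    simp [hψx, hY0]
  have hmem : ∀ t : ι → ℝ, ∑ i, t i • X i x₀ ∈ Submodule.span ℝ (range fun i => X i x₀) :=
    fun t => Submodule.sum_mem _ fun i _ =>
      Submodule.smul_mem _ _ (Submodule.subset_span (mem_range_self i))
  have hker : A.ker = ⊥ := by
    refine (Submodule.eq_bot_iff _).2 fun w hw => ?_
    have hw' : ∑ i, w.1 i • X i x₀ + w.2 = 0 := by rw [← hA]; exact hw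
    have hz : ∑ i, w.1 i • X i x₀ = 0 := by
      refine Submodule.disjoint_def.1 hS.disjoint _ (hmem _) ?_
      rw [eq_neg_of_add_eq_zero_left hw']
      exact S.neg_mem w.2.2
    rw [hz, zero_add] at hw'
    refine Prod.ext (funext fun i => ?_) (Subtype.ext hw')
    exact Fintype.linearIndependent_iff.1 hind w.1 hz i
  have hrange : A.range = ⊤ := by
    refine (Submodule.eq_top_iff').2 fun v => ?_
    obtain ⟨a, ha, b, hb, rfl⟩ := Submodule.mem_sup.1
      (hS.sup_eq_top ▸ Submodule.mem_top : v ∈ _ ⊔ S)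
    obtain ⟨t, rfl⟩ := (Submodule.mem_span_range_iff_exists_fun ℝ).1 ha
    exact ⟨(t, ⟨b, hb⟩), hA _⟩
  let A' := ContinuousLinearEquiv.ofBijective A hker hrange
  have hΨd : HasFDerivAt Ψ (A' : (ι → ℝ) × S →L[ℝ] E) 0 := by
    have : HasFDerivAt ψ (fderiv ℝ ψ (0, x₀)) (j 0) := hj0 ▸ hψd
    exact this.comp 0 (hjd 0)
  obtain ⟨e, he0, he, hes, hesymm⟩ := exists_openPartialHomeomorph_of_contDiffAt
    (f := Ψ) (f' := A') (a := 0) (by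
      filter_upwards [hjt.eventually hψ] with w hw
      exact hw.comp w hjs.contDiffAt) hΨd
  have hΨ0 : e 0 = x₀ := by rw [he]; simp [Ψ, hj0, hψx]
  have hx₀ : x₀ ∈ e.target := hΨ0 ▸ e.map_source he0
  have hsymm0 : e.symm x₀ = 0 := by rw [← hΨ0, e.left_inv he0]
  -- In these coordinates `X i` is the i-th basis vector, so any linear function has constant
  -- derivatives along the fields. Composing `l` with the derivative `A` of `Ψ` at `0` makes the
  -- differential at `x₀` equal to `l`.
  let Lf : (ι → ℝ) × S →L[ℝ] ℝ := l.comp A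
  have hfd : ∀ x ∈ e.target, (fderiv ℝ (Lf ∘ e.symm) x).comp (fderiv ℝ Ψ (e.symm x)) = Lf := by
    intro x hx
    have h1 : HasFDerivAt (Lf ∘ e.symm) (fderiv ℝ (Lf ∘ e.symm) x) (Ψ (e.symm x)) := by
      rw [← he, e.right_inv hx]
      exact (Lf.differentiableAt.comp x
        ((hesymm x hx).differentiableAt (by simp))).hasFDerivAt
    have h2 : HasFDerivAt Ψ (fderiv ℝ Ψ (e.symm x)) (e.symm x) :=
      ((hes _ (e.map_target hx)).differentiableAt (by simp)).hasFDerivAt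
    refine (h1.comp _ h2).unique (Lf.hasFDerivAt.congr_of_eventuallyEq ?_)
    filter_upwards [e.open_source.mem_nhds (e.map_target hx)] with w hw
    simp only [Function.comp_apply, ← he, e.left_inv hw]
  refine ⟨Lf ∘ e.symm, ?_, ?_, ?_⟩
  · filter_upwards [e.open_target.mem_nhds hx₀] with x hx
    exact Lf.contDiff.contDiffAt.comp x (hesymm x hx)
  · have h := hfd x₀ hx₀
    rw [hsymm0, hΨd.fderiv] at h
    ext v
    obtain ⟨w, rfl⟩ := A'.surjective v
    exact congrArg (fun B : (ι → ℝ) × S →L[ℝ] ℝ => B w) h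
  · have hct : Tendsto (fun x => j (e.symm x)) (𝓝 x₀) (𝓝 (0, x₀)) := by
      refine hjt.comp ?_
      rw [← hsymm0]
      exact (e.symm.continuousAt hx₀).tendsto
    filter_upwards [e.open_target.mem_nhds hx₀, hct.eventually hψX, hct.eventually hψ, hYXall]
      with x hx hxX hxs hYx i
    have h := hfd x hx
    have hψe : ψ (j (e.symm x)) = x := by
      have := e.right_inv hx
      rwa [he] at this
    have hd : HasFDerivAt Ψ _ (e.symm x) :=
      ((hxs.differentiableAt (by simp)).hasFDerivAt).comp _ (hjd _)
    classical
    have h1 : fderiv ℝ Ψ (e.symm x) (Pi.single i 1, 0) = X i x := by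
      rw [hd.fderiv]
      change fderiv ℝ ψ (j (e.symm x)) (Pi.single i 1, 0) = _
      rw [hxX, hψe]
      simp [Pi.single_apply, (hYx i).self_of_nhds]
    rw [← h1]
    have h2 := congrArg (fun B : (ι → ℝ) × S →L[ℝ] ℝ => B (Pi.single i 1, 0)) h
    refine h2.trans ?_
    change l (A _) = _
    rw [hA]
    simp [Pi.single_apply]

/-! ### Smooth charts and differentials read in them -/

section SmoothChart

variable {E M F : Type*} [NormedAddCommGroup E] [NormedSpace ℝ E]
  [TopologicalSpace M] [ChartedSpace E M] [NormedAddCommGroup F] [NormedSpace ℝ F]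

/-- A diffeomorphism of an open subset of `M` onto an open subset of a normed space. -/
structure IsSmoothChart (E : Type*) {M F : Type*} [NormedAddCommGroup E] [NormedSpace ℝ E]
    [TopologicalSpace M] [ChartedSpace E M] [NormedAddCommGroup F] [NormedSpace ℝ F]
    (χ : OpenPartialHomeomorph M F) : Prop where
  contMDiffAt : ∀ {x}, x ∈ χ.source → ContMDiffAt 𝓘(ℝ, E) 𝓘(ℝ, F) ∞ χ x
  contMDiffAt_symm : ∀ {y}, y ∈ χ.target → ContMDiffAt 𝓘(ℝ, F) 𝓘(ℝ, E) ∞ χ.symm y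

theorem isSmoothChart_chartAt [IsManifold 𝓘(ℝ, E) ∞ M] (m : M) :
    IsSmoothChart E (chartAt E m) where
  contMDiffAt hx := contMDiffAt_of_mem_maximalAtlas (IsManifold.chart_mem_maximalAtlas m) hx
  contMDiffAt_symm hy :=
    contMDiffAt_symm_of_mem_maximalAtlas (IsManifold.chart_mem_maximalAtlas m) hy

namespace IsSmoothChart

variable {χ : OpenPartialHomeomorph M F} (hχ : IsSmoothChart E χ) {x : M}
include hχ

theorem contMDiffAt_iff {F' : Type*} [NormedAddCommGroup F'] [NormedSpace ℝ F'] {u : M → F'}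
    (hx : x ∈ χ.source) :
    ContMDiffAt 𝓘(ℝ, E) 𝓘(ℝ, F') ∞ u x ↔ ContDiffAt ℝ ∞ (u ∘ χ.symm) (χ x) := by
  constructor
  · intro h
    refine ContMDiffAt.contDiffAt (ContMDiffAt.comp (χ x) ?_
      (hχ.contMDiffAt_symm (χ.map_source hx)))
    rwa [χ.left_inv hx]
  · intro h
    have h1 : ContMDiffAt 𝓘(ℝ, E) 𝓘(ℝ, F') ∞ ((u ∘ χ.symm) ∘ χ) x :=
      ContMDiffAt.comp x h.contMDiffAt (hχ.contMDiffAt hx)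
    refine h1.congr_of_eventuallyEq ?_
    filter_upwards [χ.open_source.mem_nhds hx] with y hy
    simp [χ.left_inv hy]

theorem mdifferentiableAt (hx : x ∈ χ.source) : MDifferentiableAt 𝓘(ℝ, E) 𝓘(ℝ, F) χ x :=
  (hχ.contMDiffAt hx).mdifferentiableAt (by simp)

theorem mdifferentiableAt_symm {y : F} (hy : y ∈ χ.target) :
    MDifferentiableAt 𝓘(ℝ, F) 𝓘(ℝ, E) χ.symm y :=
  (hχ.contMDiffAt_symm hy).mdifferentiableAt (by simp)

theorem mfderiv_symm_mfderiv (hx : x ∈ χ.source) (v : TangentSpace 𝓘(ℝ, E) x) :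
    mfderiv 𝓘(ℝ, F) 𝓘(ℝ, E) χ.symm (χ x) (mfderiv 𝓘(ℝ, E) 𝓘(ℝ, F) χ x v) = v := by
  have h := mfderiv_comp x (hχ.mdifferentiableAt_symm (χ.map_source hx)) (hχ.mdifferentiableAt hx)
  have h2 : mfderiv 𝓘(ℝ, E) 𝓘(ℝ, E) (χ.symm ∘ χ) x = mfderiv 𝓘(ℝ, E) 𝓘(ℝ, E) id x := by
    refine Filter.EventuallyEq.mfderiv_eq ?_
    filter_upwards [χ.open_source.mem_nhds hx] with y hy
    simp [χ.left_inv hy]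
  rw [h2, mfderiv_id] at h
  exact (congrArg (fun A : E →L[ℝ] E => A v) h).symm

theorem mfderiv_mfderiv_symm (hx : x ∈ χ.source) (w : F) :
    mfderiv 𝓘(ℝ, E) 𝓘(ℝ, F) χ x (mfderiv 𝓘(ℝ, F) 𝓘(ℝ, E) χ.symm (χ x) w) = w := by
  have hx' : χ.symm (χ x) = x := χ.left_inv hx
  have h := mfderiv_comp_of_eq (hχ.mdifferentiableAt hx)
    (hχ.mdifferentiableAt_symm (χ.map_source hx)) hx'
  have h2 : mfderiv 𝓘(ℝ, F) 𝓘(ℝ, F) (χ ∘ χ.symm) (χ x) = mfderiv 𝓘(ℝ, F) 𝓘(ℝ, F) id (χ x) := by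
    refine Filter.EventuallyEq.mfderiv_eq ?_
    filter_upwards [χ.open_target.mem_nhds (χ.map_source hx)] with y hy
    simp [χ.right_inv hy]
  rw [h2, mfderiv_id, hx'] at h
  exact (congrArg (fun A : F →L[ℝ] F => A w) h).symm

theorem mvfderiv_apply {u : M → ℝ} (hx : x ∈ χ.source)
    (hu : MDifferentiableAt 𝓘(ℝ, E) 𝓘(ℝ, ℝ) u x) (v : TangentSpace 𝓘(ℝ, E) x) :
    mvfderiv 𝓘(ℝ, E) u x v =
      fderiv ℝ (u ∘ χ.symm) (χ x) (mfderiv 𝓘(ℝ, E) 𝓘(ℝ, F) χ x v) := by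
  have hu' : MDifferentiableAt 𝓘(ℝ, E) 𝓘(ℝ, ℝ) u (χ.symm (χ x)) := by rwa [χ.left_inv hx]
  have h := mfderiv_comp (χ x) hu' (hχ.mdifferentiableAt_symm (χ.map_source hx))
  rw [mfderiv_eq_fderiv] at h
  rw [h]
  have h2 := hχ.mfderiv_symm_mfderiv hx v
  -- Replacing χ⁻¹(χ x) by x would change the tangent space in the type. All tangent spaces unfold
  -- to `E`, so the equality is stated over `E` and proved by substitution.
  have h3 : ∀ y, y = x → (mfderiv 𝓘(ℝ, E) 𝓘(ℝ, ℝ) u y : E →L[ℝ] ℝ) =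
    (mfderiv 𝓘(ℝ, E) 𝓘(ℝ, ℝ) u x : E →L[ℝ] ℝ) := by rintro _ rfl; rfl
  change (mfderiv 𝓘(ℝ, E) 𝓘(ℝ, ℝ) u x : E →L[ℝ] ℝ) v =
    (mfderiv 𝓘(ℝ, E) 𝓘(ℝ, ℝ) u (χ.symm (χ x)) : E →L[ℝ] ℝ) (_ : E)
  rw [h3 _ (χ.left_inv hx)]
  exact congrArg (mfderiv 𝓘(ℝ, E) 𝓘(ℝ, ℝ) u x : E →L[ℝ] ℝ) h2.symm

end IsSmoothChart

end SmoothChart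

/-! ### Integrals over a compact manifold depending on a parameter -/

section ParametricIntegral

variable {EG G : Type*} [NormedAddCommGroup EG] [NormedSpace ℝ EG] [TopologicalSpace G]
  [ChartedSpace EG G] [IsManifold 𝓘(ℝ, EG) ∞ G]
  {E : Type*} [NormedAddCommGroup E] [NormedSpace ℝ E]

theorem contMDiffAt_fderiv_param {F : G → E → ℝ} {g : G} {x : E}
    (hF : ContMDiffAt (𝓘(ℝ, EG).prod 𝓘(ℝ, E)) 𝓘(ℝ, ℝ) ∞ (Function.uncurry F) (g, x)) :
    ContMDiffAt (𝓘(ℝ, EG).prod 𝓘(ℝ, E)) 𝓘(ℝ, E →L[ℝ] ℝ) ∞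
      (fun w : G × E => fderiv ℝ (F w.1) w.2) (g, x) := by
  have h := ContMDiffAt.mfderiv (I := 𝓘(ℝ, E)) (I' := 𝓘(ℝ, ℝ)) (J := 𝓘(ℝ, EG).prod 𝓘(ℝ, E))
    (x₀ := (g, x)) (n := ∞) (m := ∞) (fun (w : G × E) (y : E) => F w.1 y) Prod.snd
    (hF.comp ((g, x), x) ((contMDiffAt_fst.comp _ contMDiffAt_fst).prodMk contMDiffAt_snd))
    contMDiffAt_snd (by simp)
  simp only [mfderiv_eq_fderiv] at h
  rw [inTangentCoordinates_model_space] at h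
  exact h

variable [CompactSpace G] [MeasurableSpace G] [BorelSpace G] (μ : Measure G) [IsFiniteMeasure μ]
  [FiniteDimensional ℝ E]

theorem Continuous.integrable_of_compactSpace {F : Type*} [NormedAddCommGroup F]
    [SecondCountableTopology F] {f : G → F} (hf : Continuous f) : Integrable f μ := by
  borelize F
  obtain ⟨C, hC⟩ := isCompact_univ.exists_bound_of_continuousOn hf.continuousOn
  exact Integrable.of_bound hf.aestronglyMeasurable C
    (Eventually.of_forall fun g => hC g (mem_univ g))

/-- Dominated convergence: the derivative in x is jointly continuous, hence bounded on the compact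
product of G with a closed ball in W, and constants are integrable for a finite measure. -/
theorem hasFDerivAt_integral_param {W : Set E} (hW : IsOpen W) {F : G → E → ℝ}
    (hF : ∀ x ∈ W, ∀ g,
      ContMDiffAt (𝓘(ℝ, EG).prod 𝓘(ℝ, E)) 𝓘(ℝ, ℝ) ∞ (Function.uncurry F) (g, x))
    {x : E} (hx : x ∈ W) :
    HasFDerivAt (fun x => ∫ g, F g x ∂μ) (∫ g, fderiv ℝ (F g) x ∂μ) x := by
  have hsec : ∀ y : E, Continuous fun g : G => (g, y) := fun y => by fun_prop
  have hcF : ∀ y ∈ W, Continuous fun g => F g y := fun y hy => continuous_iff_continuousAt.2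
    fun g => ContinuousAt.comp (g := Function.uncurry F) (f := fun g : G => (g, y)) (hF y hy g).continuousAt
      (hsec y).continuousAt
  have hcD : ∀ y ∈ W, Continuous fun g => fderiv ℝ (F g) y := fun y hy =>
    continuous_iff_continuousAt.2 fun g =>
      ContinuousAt.comp (g := fun w : G × E => fderiv ℝ (F w.1) w.2) (f := fun g : G => (g, y))
        (contMDiffAt_fderiv_param (hF y hy g)).continuousAt (hsec y).continuousAt
  obtain ⟨ε, hε, hb⟩ := Metric.nhds_basis_closedBall.mem_iff.1 (hW.mem_nhds hx)
  obtain ⟨C, hC⟩ := ((isCompact_univ (X := G)).prod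
    (isCompact_closedBall x ε)).exists_bound_of_continuousOn
      (f := fun w : G × E => fderiv ℝ (F w.1) w.2) (fun w hw =>
        (contMDiffAt_fderiv_param (hF w.2 (hb hw.2) w.1)).continuousAt.continuousWithinAt)
  refine hasFDerivAt_integral_of_dominated_of_fderiv_le (F := fun y g => F g y)
    (F' := fun y g => fderiv ℝ (F g) y) (bound := fun _ => C)
    (Metric.closedBall_mem_nhds x hε) ?_ ?_ ?_ ?_ (integrable_const C) ?_
  · filter_upwards [hW.mem_nhds hx] with y hy
    exact ((hcF y hy).integrable_of_compactSpace μ).aestronglyMeasurable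
  · exact (hcF x hx).integrable_of_compactSpace μ
  · exact ((hcD x hx).integrable_of_compactSpace μ).aestronglyMeasurable
  · exact Eventually.of_forall fun g y hy => hC (g, y) ⟨mem_univ g, hy⟩
  · refine Eventually.of_forall fun g y hy => ?_
    have h : ContMDiffAt 𝓘(ℝ, E) 𝓘(ℝ, ℝ) ∞ (F g) y :=
      (hF y (hb hy) g).comp y (contMDiffAt_const.prodMk contMDiffAt_id)
    exact (h.contDiffAt.differentiableAt (by simp)).hasFDerivAt

/-- Induction through directional derivatives: for fixed v, the derivative along v is again the
integral of a real-valued, jointly smooth family. Vector-valued families never enter the induction.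
-/
theorem contDiffOn_integral_param_nat (n : ℕ) {W : Set E} (hW : IsOpen W) :
    ∀ {F : G → E → ℝ}, (∀ x ∈ W, ∀ g,
      ContMDiffAt (𝓘(ℝ, EG).prod 𝓘(ℝ, E)) 𝓘(ℝ, ℝ) ∞ (Function.uncurry F) (g, x)) →
    ContDiffOn ℝ n (fun x => ∫ g, F g x ∂μ) W := by
  induction n with
  | zero =>
    intro F hF
    exact contDiffOn_zero.2 fun x hx =>
      (hasFDerivAt_integral_param μ hW hF hx).continuousAt.continuousWithinAt
  | succ n ih =>
    intro F hF
    have hd := fun x hx => hasFDerivAt_integral_param μ hW hF (x := x) hx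
    refine (contDiffOn_succ_iff_fderiv_apply hW.uniqueDiffOn).2
      ⟨fun x hx => (hd x hx).differentiableAt.differentiableWithinAt, fun h => absurd h (WithTop.natCast_ne_top n), fun v => ?_⟩
    refine (ih (F := fun g x => fderiv ℝ (F g) x v) fun x hx g =>
      (contMDiffAt_fderiv_param (hF x hx g)).clm_apply contMDiffAt_const).congr fun x hx => ?_
    rw [fderivWithin_of_isOpen hW hx, (hd x hx).fderiv]
    refine ContinuousLinearMap.integral_apply (Continuous.integrable_of_compactSpace μ ?_) v
    exact continuous_iff_continuousAt.2 fun g =>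
      ContinuousAt.comp (g := fun w : G × E => fderiv ℝ (F w.1) w.2) (f := fun g : G => (g, x))
        (contMDiffAt_fderiv_param (hF x hx g)).continuousAt (by fun_prop)

variable {M : Type*} [TopologicalSpace M] [ChartedSpace E M] [IsManifold 𝓘(ℝ, E) ∞ M]

/-- Integrals over a compact manifold of functions depending smoothly on a parameter are smooth,
and can be differentiated under the integral sign. -/
theorem contMDiffAt_integral_param {m : M} {F : G → M → ℝ} (hF : ∀ᶠ x in 𝓝 m, ∀ g,
      ContMDiffAt (𝓘(ℝ, EG).prod 𝓘(ℝ, E)) 𝓘(ℝ, ℝ) ∞ (Function.uncurry F) (g, x)) :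
    ∀ᶠ x in 𝓝 m, ContMDiffAt 𝓘(ℝ, E) 𝓘(ℝ, ℝ) ∞ (fun x => ∫ g, F g x ∂μ) x ∧
      ∀ v : TangentSpace 𝓘(ℝ, E) x, mvfderiv 𝓘(ℝ, E) (fun x => ∫ g, F g x ∂μ) x v =
        ∫ g, mvfderiv 𝓘(ℝ, E) (F g) x v ∂μ := by
  obtain ⟨W, hW, hWo, hmW⟩ := eventually_nhds_iff.1 hF
  have hχ : IsSmoothChart E (chartAt E m) := isSmoothChart_chartAt m
  set χ := chartAt E m
  have hW' : IsOpen (χ.target ∩ χ.symm ⁻¹' W) := χ.isOpen_inter_preimage_symm hWo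
  have hF' : ∀ y ∈ χ.target ∩ χ.symm ⁻¹' W, ∀ g,
      ContMDiffAt (𝓘(ℝ, EG).prod 𝓘(ℝ, E)) 𝓘(ℝ, ℝ) ∞
        (Function.uncurry fun g y => F g (χ.symm y)) (g, y) := fun y hy g => by
    refine ContMDiffAt.comp (g := Function.uncurry F) (f := fun w : G × E => (w.1, χ.symm w.2))
      (g, y) (hW _ hy.2 g) (contMDiffAt_fst.prodMk ?_)
    exact ContMDiffAt.comp (g := χ.symm) (g, y) (hχ.contMDiffAt_symm hy.1) contMDiffAt_snd
  have hsm : ContDiffOn ℝ ∞ (fun y => ∫ g, F g (χ.symm y) ∂μ) (χ.target ∩ χ.symm ⁻¹' W) :=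
    contDiffOn_infty.2 fun n => contDiffOn_integral_param_nat μ n hW' hF'
  filter_upwards [hWo.mem_nhds hmW, χ.open_source.mem_nhds (mem_chart_source E m)] with x hxW hx
  have hxW' : χ x ∈ χ.target ∩ χ.symm ⁻¹' W :=
    ⟨χ.map_source hx, by rwa [mem_preimage, χ.left_inv hx]⟩
  have h1 : ContMDiffAt 𝓘(ℝ, E) 𝓘(ℝ, ℝ) ∞ (fun x => ∫ g, F g x ∂μ) x :=
    (hχ.contMDiffAt_iff hx).2 (hsm.contDiffAt (hW'.mem_nhds hxW'))
  refine ⟨h1, fun v => ?_⟩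
  rw [hχ.mvfderiv_apply hx (h1.mdifferentiableAt (by simp))]
  have h2 := hasFDerivAt_integral_param μ hW' hF' hxW'
  have h3 : fderiv ℝ ((fun x => ∫ g, F g x ∂μ) ∘ χ.symm) (χ x) =
    ∫ g, fderiv ℝ (F g ∘ χ.symm) (χ x) ∂μ := h2.fderiv
  rw [h3]
  have hint : Integrable (fun g => fderiv ℝ (F g ∘ χ.symm) (χ x)) μ :=
    Continuous.integrable_of_compactSpace μ (continuous_iff_continuousAt.2 fun g =>
      ContinuousAt.comp (g := fun w : G × E => fderiv ℝ (F w.1 ∘ χ.symm) w.2)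
        (f := fun g : G => (g, χ x))
        (contMDiffAt_fderiv_param (hF' _ hxW' g)).continuousAt (by fun_prop))
  refine (ContinuousLinearMap.integral_apply hint _).trans (integral_congr_ae ?_)
  refine Eventually.of_forall fun g => (hχ.mvfderiv_apply hx ?_ v).symm
  have h : ContMDiffAt 𝓘(ℝ, E) 𝓘(ℝ, ℝ) ∞ (F g) x :=
    (hW x hxW g).comp x (contMDiffAt_const.prodMk contMDiffAt_id)
  exact h.mdifferentiableAt (by simp)

end ParametricIntegral

/-! ### Smooth germs and the calculus of brackets -/

/-- `f` is smooth in a neighbourhood of `m`. -/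
def SmoothNear (E : Type*) {M : Type*} [NormedAddCommGroup E] [NormedSpace ℝ E]
    [TopologicalSpace M] [ChartedSpace E M] (f : M → ℝ) (m : M) : Prop :=
  ∀ᶠ x in 𝓝 m, ContMDiffAt 𝓘(ℝ, E) 𝓘(ℝ, ℝ) ∞ f x

theorem contDiffAt_of_forall_clm {E F : Type*} [NormedAddCommGroup E] [NormedSpace ℝ E]
    [NormedAddCommGroup F] [NormedSpace ℝ F] [FiniteDimensional ℝ F] {f : E → F} {x : E}
    {n : WithTop ℕ∞} (h : ∀ l : F →L[ℝ] ℝ, ContDiffAt ℝ n (fun y => l (f y)) x) :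
    ContDiffAt ℝ n f x := by
  let e : F ≃L[ℝ] (Fin (Module.finrank ℝ F) → ℝ) := ContinuousLinearEquiv.ofFinrankEq (by simp)
  refine (e.comp_contDiffAt_iff).1 (contDiffAt_pi.2 fun i => ?_)
  exact h ((ContinuousLinearMap.proj (R := ℝ) (φ := fun _ => ℝ) i).comp (e : F →L[ℝ] _))

namespace SmoothNear

variable {E M : Type*} [NormedAddCommGroup E] [NormedSpace ℝ E]
  [TopologicalSpace M] [ChartedSpace E M] {f g h : M → ℝ} {m : M}

theorem eventually (hf : SmoothNear E f m) : ∀ᶠ x in 𝓝 m, SmoothNear E f x :=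
  hf.eventually_nhds

theorem contMDiffAt (hf : SmoothNear E f m) : ContMDiffAt 𝓘(ℝ, E) 𝓘(ℝ, ℝ) ∞ f m :=
  hf.self_of_nhds

theorem mdifferentiableAt (hf : SmoothNear E f m) : MDifferentiableAt 𝓘(ℝ, E) 𝓘(ℝ, ℝ) f m :=
  hf.contMDiffAt.mdifferentiableAt (by simp)

theorem of_contMDiffOn {V : Set M} (hV : IsOpen V) (hm : m ∈ V)
    (hf : ContMDiffOn 𝓘(ℝ, E) 𝓘(ℝ, ℝ) ∞ f V) : SmoothNear E f m := by
  filter_upwards [hV.mem_nhds hm] with x hx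
  exact hf.contMDiffAt (hV.mem_nhds hx)

theorem sub_const (hf : SmoothNear E f m) (c : ℝ) : SmoothNear E (fun x => f x - c) m := by
  filter_upwards [hf] with x hx
  exact hx.sub contMDiffAt_const

end SmoothNear

namespace PoissonStructure

variable {E M : Type*} [NormedAddCommGroup E] [NormedSpace ℝ E]
  [TopologicalSpace M] [ChartedSpace E M] (P : PoissonStructure E M) {f g h f' : M → ℝ} {m x : M}

theorem bracket_eq_mvfderiv :
    P.bracket f g x = mvfderiv 𝓘(ℝ, E) f x (P.hamiltonian g x) := rfl

theorem bracket_swap : P.bracket f g x = -P.bracket g f x := P.skew _ _ _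

theorem bracket_self : P.bracket f f x = 0 := by
  have := P.bracket_swap (f := f) (g := f) (x := x)
  linarith

theorem mvfderiv_congr (hff : f =ᶠ[𝓝 x] f') : mvfderiv 𝓘(ℝ, E) f x = mvfderiv 𝓘(ℝ, E) f' x := by
  ext v
  have h := hff.mfderiv_eq (I := 𝓘(ℝ, E)) (I' := 𝓘(ℝ, ℝ))
  exact congrArg (fun A : E →L[ℝ] ℝ => A v) h

theorem bracket_congr_left (hff : f =ᶠ[𝓝 x] f') : P.bracket f g x = P.bracket f' g x := by
  rw [bracket_eq_mvfderiv, bracket_eq_mvfderiv, mvfderiv_congr hff]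

theorem bracket_congr_right (hff : f =ᶠ[𝓝 x] f') : P.bracket g f x = P.bracket g f' x := by
  rw [bracket_swap, P.bracket_congr_left hff, ← bracket_swap]

theorem bracket_const_left {c : ℝ} (hf : ∀ᶠ y in 𝓝 x, f y = c) : P.bracket f g x = 0 := by
  rw [P.bracket_congr_left (f' := fun _ => c) hf, bracket_eq_mvfderiv]
  have : mvfderiv 𝓘(ℝ, E) (fun _ : M => c) x = 0 := mvfderiv_const c
  rw [this]
  rfl

theorem smoothNear_bracket (hf : SmoothNear E f m) (hg : SmoothNear E g m) :
    SmoothNear E (P.bracket f g) m := by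
  obtain ⟨W, hW, hWo, hm⟩ := eventually_nhds_iff.1 (hf.and hg)
  exact SmoothNear.of_contMDiffOn hWo hm (P.smooth W f g hWo
    (fun x hx => (hW x hx).1.contMDiffWithinAt) fun x hx => (hW x hx).2.contMDiffWithinAt)

theorem jacobi_identity (hf : SmoothNear E f x) (hg : SmoothNear E g x) (hh : SmoothNear E h x) :
    P.bracket (P.bracket f g) h x + P.bracket (P.bracket g h) f x +
      P.bracket (P.bracket h f) g x = 0 := by
  obtain ⟨W, hW, hWo, hm⟩ := eventually_nhds_iff.1 (hf.and (hg.and hh))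
  exact P.jacobi W f g h hWo (fun x hx => (hW x hx).1.contMDiffWithinAt)
    (fun x hx => (hW x hx).2.1.contMDiffWithinAt)
    (fun x hx => (hW x hx).2.2.contMDiffWithinAt) x hm

/-! ### Hamiltonian vector fields in a chart -/

section Chart

variable {F : Type*} [NormedAddCommGroup F] [NormedSpace ℝ F]

/-- The expression of the Hamiltonian vector field of `g` in the chart `χ`. -/
noncomputable def localField (χ : OpenPartialHomeomorph M F) (g : M → ℝ) (y : F) : F :=
  mfderiv 𝓘(ℝ, E) 𝓘(ℝ, F) χ (χ.symm y) (P.hamiltonian g (χ.symm y))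

variable {χ : OpenPartialHomeomorph M F}

theorem localField_apply (hx : x ∈ χ.source) :
    P.localField χ g (χ x) = mfderiv 𝓘(ℝ, E) 𝓘(ℝ, F) χ x (P.hamiltonian g x) :=
  congrArg (fun a => (mfderiv 𝓘(ℝ, E) 𝓘(ℝ, F) χ a (P.hamiltonian g a) : F)) (χ.left_inv hx)

variable (hχ : IsSmoothChart E χ)
include hχ

theorem bracket_eq_fderiv (hx : x ∈ χ.source) (hf : MDifferentiableAt 𝓘(ℝ, E) 𝓘(ℝ, ℝ) f x) :
    P.bracket f g x = fderiv ℝ (f ∘ χ.symm) (χ x) (P.localField χ g (χ x)) := by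
  rw [bracket_eq_mvfderiv, hχ.mvfderiv_apply hx hf, P.localField_apply hx]

/-- The coordinates of a Hamiltonian field are brackets with coordinate functions. Through this
formula the smoothness and Jacobi axioms, which concern functions only, become statements about
vector fields. -/
theorem clm_localField (l : F →L[ℝ] ℝ) (hx : x ∈ χ.source) :
    l (P.localField χ g (χ x)) = P.bracket (l ∘ χ) g x := by
  rw [bracket_eq_mvfderiv, P.localField_apply hx, mvfderiv_comp_apply x
    (mdifferentiableAt_iff_differentiableAt.2 l.differentiableAt) (hχ.mdifferentiableAt hx)]
  have : mvfderiv 𝓘(ℝ, F) l (χ x) = l := by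
    ext v
    exact congrArg (fun A : F →L[ℝ] ℝ => A v) (mfderiv_eq_fderiv.trans l.fderiv)
  rw [this]
  rfl

theorem smoothNear_clm_comp (l : F →L[ℝ] ℝ) (hm : m ∈ χ.source) : SmoothNear E (l ∘ χ) m := by
  filter_upwards [χ.open_source.mem_nhds hm] with x hx
  exact l.contDiff.contDiffAt.contMDiffAt.comp x (hχ.contMDiffAt hx)

theorem clm_localField_eventuallyEq (l : F →L[ℝ] ℝ) (hx : x ∈ χ.source) :
    (fun y => l (P.localField χ g y)) =ᶠ[𝓝 (χ x)] P.bracket (l ∘ χ) g ∘ χ.symm := by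
  filter_upwards [χ.open_target.mem_nhds (χ.map_source hx)] with y hy
  have := P.clm_localField hχ l (g := g) (χ.map_target hy)
  rwa [χ.right_inv hy] at this

theorem contDiffAt_localField [FiniteDimensional ℝ F] (hx : x ∈ χ.source) (hg : SmoothNear E g x) :
    ContDiffAt ℝ ∞ (P.localField χ g) (χ x) :=
  contDiffAt_of_forall_clm fun l =>
    ((hχ.contMDiffAt_iff hx).1 (P.smoothNear_bracket (smoothNear_clm_comp hχ l hx)
      hg).contMDiffAt).congr_of_eventuallyEq (P.clm_localField_eventuallyEq hχ l hx)

theorem clm_fderiv_localField [FiniteDimensional ℝ F] (l : F →L[ℝ] ℝ) (hx : x ∈ χ.source)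
    (hf : SmoothNear E f x) :
    l (fderiv ℝ (P.localField χ f) (χ x) (P.localField χ g (χ x))) =
      P.bracket (P.bracket (l ∘ χ) f) g x := by
  have hd := (P.contDiffAt_localField hχ hx hf).differentiableAt (by simp)
  have h0 : HasFDerivAt l l (P.localField χ f (χ x)) := l.hasFDerivAt
  have h1 : fderiv ℝ (fun y => l (P.localField χ f y)) (χ x) =
      l.comp (fderiv ℝ (P.localField χ f) (χ x)) := (h0.comp (χ x) hd.hasFDerivAt).fderiv
  have h2 := (P.clm_localField_eventuallyEq hχ (g := f) l hx).fderiv_eq (𝕜 := ℝ)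
  rw [P.bracket_eq_fderiv hχ hx
    (P.smoothNear_bracket (smoothNear_clm_comp hχ l hx) hf).mdifferentiableAt, ← h2]
  exact (congrArg (fun A : F →L[ℝ] ℝ => A (P.localField χ g (χ x))) h1).symm

/-- On a coordinate function u the two sides are {{u, f}, g} and {{u, g}, f}. By the Jacobi identity
they differ, up to sign, by {{f, g}, u}, which vanishes when {f, g} is locally constant. -/
theorem localField_comm [FiniteDimensional ℝ F] (hx : x ∈ χ.source)
    (hf : SmoothNear E f x) (hg : SmoothNear E g x) {c : ℝ}
    (hc : ∀ᶠ y in 𝓝 x, P.bracket f g y = c) :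
    fderiv ℝ (P.localField χ f) (χ x) (P.localField χ g (χ x)) =
      fderiv ℝ (P.localField χ g) (χ x) (P.localField χ f (χ x)) := by
  let e : F ≃L[ℝ] (Fin (Module.finrank ℝ F) → ℝ) := ContinuousLinearEquiv.ofFinrankEq (by simp)
  refine e.injective (funext fun i => ?_)
  let l : F →L[ℝ] ℝ := (ContinuousLinearMap.proj (R := ℝ) (φ := fun _ => ℝ) i).comp (e : F →L[ℝ] _)
  have h1 := P.clm_fderiv_localField hχ (g := g) l hx hf
  have h2 := P.clm_fderiv_localField hχ (g := f) l hx hg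
  have hu := smoothNear_clm_comp hχ l hx
  have hj := P.jacobi_identity hu hf hg
  have h3 := P.bracket_const_left (g := l ∘ χ) hc
  have h4 : P.bracket (P.bracket g (l ∘ χ)) f x = -P.bracket (P.bracket (l ∘ χ) g) f x := by
    rw [P.bracket_swap (f := P.bracket g (l ∘ χ)), P.bracket_swap (f := P.bracket (l ∘ χ) g),
      neg_neg, bracket_eq_mvfderiv, P.bracket_eq_mvfderiv]
    have : P.bracket g (l ∘ χ) = -P.bracket (l ∘ χ) g := funext fun y => P.bracket_swap
    rw [hamiltonian, hamiltonian, this, mvfderiv_neg, map_neg, map_neg, neg_neg]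
  change l _ = l _
  rw [h1, h2]
  rw [h3, h4] at hj
  linarith

end Chart

/-- Every covector at `m` is the differential of a function having constant brackets with given
functions `f i`, if these have constant brackets among themselves and independent Hamiltonian vector
fields at `m`. -/
theorem exists_bracket_eq_const [FiniteDimensional ℝ E] [IsManifold 𝓘(ℝ, E) ∞ M] {ι : Type*}
    [Finite ι] {f : ι → M → ℝ} (hf : ∀ i, SmoothNear E (f i) m)
    (hbr : ∀ i j, ∃ c, ∀ᶠ x in 𝓝 m, P.bracket (f i) (f j) x = c)
    (hind : LinearIndependent ℝ fun i => P.hamiltonian (f i) m)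
    (l : TangentSpace 𝓘(ℝ, E) m →L[ℝ] ℝ) :
    ∃ u : M → ℝ, SmoothNear E u m ∧ mvfderiv 𝓘(ℝ, E) u m = l ∧
      ∀ i, ∀ᶠ x in 𝓝 m, P.bracket u (f i) x = l (P.hamiltonian (f i) m) := by
  have := Fintype.ofFinite ι
  have hχ : IsSmoothChart E (chartAt E m) := isSmoothChart_chartAt m
  set χ := chartAt E m
  have hm : m ∈ χ.source := mem_chart_source E m
  have hm' : χ m ∈ χ.target := χ.map_source hm
  have hsymm : Tendsto χ.symm (𝓝 (χ m)) (𝓝 m) := by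
    have := (χ.symm.continuousAt hm').tendsto
    rwa [χ.left_inv hm] at this
  choose c hc using hbr
  let l' : E →L[ℝ] ℝ := l.comp (mfderiv 𝓘(ℝ, E) 𝓘(ℝ, E) χ.symm (χ m) : E →L[ℝ] E)
  have hl' : ∀ v : TangentSpace 𝓘(ℝ, E) m, l' (mfderiv 𝓘(ℝ, E) 𝓘(ℝ, E) χ m v) = l v := fun v =>
    congrArg l (hχ.mfderiv_symm_mfderiv hm v)
  obtain ⟨u, hu, hul, hub⟩ := exists_contDiffAt_fderiv_commuting_const
    (fun i => P.localField χ (f i)) (χ m) (fun i => by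
      filter_upwards [χ.open_target.mem_nhds hm', hsymm.eventually (hf i).eventually] with y hy hyf
      have := P.contDiffAt_localField hχ (χ.map_target hy) hyf
      rwa [χ.right_inv hy] at this)
    (by
      filter_upwards [χ.open_target.mem_nhds hm',
        hsymm.eventually (eventually_all.2 fun i => (hf i).eventually),
        hsymm.eventually (eventually_all.2 fun i => eventually_all.2 fun j =>
          (hc i j).eventually_nhds)] with y hy hyf hyc i j
      have := P.localField_comm hχ (χ.map_target hy) (hyf i) (hyf j) (hyc i j)
      rwa [χ.right_inv hy] at this)
    (by
      have h := hind.map' (mfderiv 𝓘(ℝ, E) 𝓘(ℝ, E) χ m).toLinearMap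
        (LinearMap.ker_eq_bot.2 (Function.LeftInverse.injective
          (g := mfderiv 𝓘(ℝ, E) 𝓘(ℝ, E) χ.symm (χ m)) (hχ.mfderiv_symm_mfderiv hm)))
      have he : (fun i => P.localField χ (f i) (χ m)) = fun i =>
          (mfderiv 𝓘(ℝ, E) 𝓘(ℝ, E) χ m (P.hamiltonian (f i) m) : E) :=
        funext fun i => P.localField_apply hm
      rw [he]
      exact h) l'
  have hus : SmoothNear E (u ∘ χ) m := by
    filter_upwards [χ.open_source.mem_nhds hm, (χ.continuousAt hm).eventually hu] with x hx hxu
    exact hxu.contMDiffAt.comp x (hχ.contMDiffAt hx)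
  have hcomp : ∀ x ∈ χ.source, (u ∘ χ) ∘ χ.symm =ᶠ[𝓝 (χ x)] u := fun x hx => by
    filter_upwards [χ.open_target.mem_nhds (χ.map_source hx)] with y hy
    simp [χ.right_inv hy]
  refine ⟨u ∘ χ, hus, ?_, fun i => ?_⟩
  · ext v
    rw [hχ.mvfderiv_apply hm hus.mdifferentiableAt, (hcomp m hm).fderiv_eq, hul, hl']
  · filter_upwards [χ.open_source.mem_nhds hm, (χ.continuousAt hm).eventually hub,
      hus.eventually] with x hx hxu hxs
    rw [P.bracket_eq_fderiv hχ hx hxs.mdifferentiableAt, (hcomp x hx).fderiv_eq, hxu,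
      P.localField_apply hm, hl']

end PoissonStructure

/-! ### Sums and families of differentials -/

section Differential

variable {E M : Type*} [NormedAddCommGroup E] [NormedSpace ℝ E]
  [TopologicalSpace M] [ChartedSpace E M] {m x : M}

theorem SmoothNear.sum {κ : Type*} {s : Finset κ} {u : κ → M → ℝ}
    (hu : ∀ k, SmoothNear E (u k) m) : SmoothNear E (fun x => ∑ k ∈ s, u k x) m := by
  classical
  induction s using Finset.induction_on with
  | empty => exact Eventually.of_forall fun x => by simpa using contMDiffAt_const
  | insert a s ha ih =>
    filter_upwards [ih, hu a] with x hx hax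
    simp only [Finset.sum_insert ha]
    exact hax.add hx

theorem mvfderiv_sum {κ : Type*} {s : Finset κ} {u : κ → M → ℝ}
    (hu : ∀ k, MDifferentiableAt 𝓘(ℝ, E) 𝓘(ℝ, ℝ) (u k) x) :
    MDifferentiableAt 𝓘(ℝ, E) 𝓘(ℝ, ℝ) (fun x => ∑ k ∈ s, u k x) x ∧
    mvfderiv 𝓘(ℝ, E) (fun x => ∑ k ∈ s, u k x) x = ∑ k ∈ s, mvfderiv 𝓘(ℝ, E) (u k) x := by
  classical
  induction s using Finset.induction_on with
  | empty =>
    simp only [Finset.sum_empty]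
    exact ⟨mdifferentiableAt_const, mvfderiv_const 0⟩
  | insert a s ha ih =>
    simp only [Finset.sum_insert ha]
    exact ⟨(hu a).add ih.1, by rw [mvfderiv_fun_add (hu a) ih.1, ih.2]⟩

theorem mvfderiv_const_mul {u : M → ℝ} (c : ℝ) (hu : MDifferentiableAt 𝓘(ℝ, E) 𝓘(ℝ, ℝ) u x) :
    mvfderiv 𝓘(ℝ, E) (fun x => c * u x) x = c • mvfderiv 𝓘(ℝ, E) u x := by
  have h : mvfderiv 𝓘(ℝ, E) (fun _ : M => c) x = 0 := mvfderiv_const c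
  rw [mvfderiv_fun_mul mdifferentiableAt_const hu, h]
  simp

theorem mvfderiv_sub_const {u : M → ℝ} (c : ℝ) (hu : MDifferentiableAt 𝓘(ℝ, E) 𝓘(ℝ, ℝ) u x) :
    mvfderiv 𝓘(ℝ, E) (fun x => u x - c) x = mvfderiv 𝓘(ℝ, E) u x := by
  have h : mvfderiv 𝓘(ℝ, E) (fun _ : M => c) x = 0 := mvfderiv_const c
  rw [mvfderiv_fun_sub hu mdifferentiableAt_const, h, sub_zero]

theorem PoissonStructure.bracket_sub_const (P : PoissonStructure E M) {u f : M → ℝ} (c : ℝ)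
    (hu : MDifferentiableAt 𝓘(ℝ, E) 𝓘(ℝ, ℝ) u x) :
    P.bracket (fun x => u x - c) f x = P.bracket u f x := by
  rw [P.bracket_eq_mvfderiv, mvfderiv_sub_const c hu, P.bracket_eq_mvfderiv]

end Differential

section Param

variable {E M : Type*} [NormedAddCommGroup E] [NormedSpace ℝ E]
  [TopologicalSpace M] [ChartedSpace E M] [IsManifold 𝓘(ℝ, E) ∞ M]
  {EG : Type*} [NormedAddCommGroup EG] [NormedSpace ℝ EG]
  {G : Type*} [TopologicalSpace G] [ChartedSpace EG G] [IsManifold 𝓘(ℝ, EG) ∞ G] {m : M}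

/-- The differentials at a point of a smooth family of functions depend smoothly on the
parameter. -/
theorem contMDiff_mvfderiv_param {F : G → M → ℝ} (hF : ∀ g,
      ContMDiffAt (𝓘(ℝ, EG).prod 𝓘(ℝ, E)) 𝓘(ℝ, ℝ) ∞ (Function.uncurry F) (g, m))
    (v : TangentSpace 𝓘(ℝ, E) m) :
    ContMDiff 𝓘(ℝ, EG) 𝓘(ℝ, ℝ) ∞ (fun g => mvfderiv 𝓘(ℝ, E) (F g) m v) := by
  have hχ : IsSmoothChart E (chartAt E m) := isSmoothChart_chartAt m
  set χ := chartAt E m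
  have hm : m ∈ χ.source := mem_chart_source E m
  intro g
  have h1 : ContMDiffAt (𝓘(ℝ, EG).prod 𝓘(ℝ, E)) 𝓘(ℝ, ℝ) ∞
      (Function.uncurry fun g y => F g (χ.symm y)) (g, χ m) := by
    have hs : ContMDiffAt (𝓘(ℝ, EG).prod 𝓘(ℝ, E)) 𝓘(ℝ, E) ∞ (fun w : G × E => χ.symm w.2)
        (g, χ m) := ContMDiffAt.comp (g := χ.symm) (g, χ m)
      (hχ.contMDiffAt_symm (χ.map_source hm)) contMDiffAt_snd
    refine ContMDiffAt.comp (g := Function.uncurry F) (f := fun w : G × E => (w.1, χ.symm w.2))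
      (g, χ m) ?_ (contMDiffAt_fst.prodMk hs)
    simpa [χ.left_inv hm] using hF g
  have h2 : ContMDiffAt 𝓘(ℝ, EG) 𝓘(ℝ, E →L[ℝ] ℝ) ∞
      (fun g => fderiv ℝ (F g ∘ χ.symm) (χ m)) g :=
    ContMDiffAt.comp (g := fun w : G × E => fderiv ℝ (F w.1 ∘ χ.symm) w.2)
      (f := fun g : G => (g, χ m)) g (contMDiffAt_fderiv_param h1)
        (contMDiffAt_id.prodMk contMDiffAt_const)
  have h3 : ContMDiffAt 𝓘(ℝ, EG) 𝓘(ℝ, ℝ) ∞ (fun g => fderiv ℝ (F g ∘ χ.symm) (χ m)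
      (mfderiv 𝓘(ℝ, E) 𝓘(ℝ, E) χ m v : E)) g :=
    h2.clm_apply contMDiffAt_const
  refine h3.congr_of_eventuallyEq (Eventually.of_forall fun g => hχ.mvfderiv_apply hm ?_ v)
  have h : ContMDiffAt 𝓘(ℝ, E) 𝓘(ℝ, ℝ) ∞ (F g) m :=
    (hF g).comp m (contMDiffAt_const.prodMk contMDiffAt_id)
  exact h.mdifferentiableAt (by simp)

end Param

/-! ### Compact group actions near a fixed point, and averaging -/

section Action

variable {E M : Type*} [NormedAddCommGroup E] [NormedSpace ℝ E]
  [TopologicalSpace M] [ChartedSpace E M]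
  {EG : Type*} [NormedAddCommGroup EG] [NormedSpace ℝ EG]
  {G : Type*} [Group G] [TopologicalSpace G] [ChartedSpace EG G]
  [MulAction G M] {m x : M}

/-- Tube lemma: the action sends (m, g) to m for every g in the compact group, so one neighbourhood
of m serves all g. -/
theorem eventually_forall_smul [CompactSpace G] [ContinuousSMul G M] (hm : ∀ g : G, g • m = m)
    {p : M → Prop} (hp : ∀ᶠ x in 𝓝 m, p x) : ∀ᶠ x in 𝓝 m, ∀ g : G, p (g • x) := by
  have := (isCompact_univ (X := G)).eventually_forall_of_forall_eventually (x₀ := m)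
    (P := fun x g => p (g • x)) fun g _ => by
      have hc : Tendsto (fun z : M × G => z.2 • z.1) (𝓝 (m, g)) (𝓝 m) := by
        have : ContinuousAt (fun z : M × G => z.2 • z.1) (m, g) := by fun_prop
        simpa [ContinuousAt, hm g] using this
      exact hc.eventually hp
  filter_upwards [this] with x hx g using hx g (mem_univ g)

theorem mdifferentiable_smul [ContMDiffSMul 𝓘(ℝ, EG) 𝓘(ℝ, E) ∞ G M] (g : G) :
    MDifferentiable 𝓘(ℝ, E) 𝓘(ℝ, E) (fun x : M => g • x) := by
  have h : ContMDiff 𝓘(ℝ, E) 𝓘(ℝ, E) ∞ (fun x : M => g • x) :=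
    (contMDiff_smul (I := 𝓘(ℝ, EG)) (I' := 𝓘(ℝ, E)) (n := ∞) (G := G) (M := M)).comp
      (contMDiff_const.prodMk contMDiff_id)
  exact h.mdifferentiable (by simp)

/-- If two functions have the same differential at a fixed point, so have their translates. -/
theorem mvfderiv_comp_smul_congr [ContMDiffSMul 𝓘(ℝ, EG) 𝓘(ℝ, E) ∞ G M]
    {g : G} (hm : g • m = m) {u u' : M → ℝ} (hu : MDifferentiableAt 𝓘(ℝ, E) 𝓘(ℝ, ℝ) u m)
    (hu' : MDifferentiableAt 𝓘(ℝ, E) 𝓘(ℝ, ℝ) u' m)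
    (h : mvfderiv 𝓘(ℝ, E) u m = mvfderiv 𝓘(ℝ, E) u' m) :
    mvfderiv 𝓘(ℝ, E) (fun x => u (g • x)) m = mvfderiv 𝓘(ℝ, E) (fun x => u' (g • x)) m := by
  have hs := mdifferentiable_smul (EG := EG) (E := E) (M := M) g m
  have e := mvfderiv_comp_of_eq hu hs hm
  have e' := mvfderiv_comp_of_eq hu' hs hm
  have hk : ∀ y, y = m → mvfderiv 𝓘(ℝ, E) u y = mvfderiv 𝓘(ℝ, E) u' y := by
    rintro _ rfl
    exact h
  rw [hk _ hm] at e
  exact e.trans e'.symm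

theorem PoissonStructure.bracket_comp_smul [ContMDiffSMul 𝓘(ℝ, EG) 𝓘(ℝ, E) ∞ G M]
    (P : PoissonStructure E M) {g : G} (hP : P.IsPreservedBy (fun x : M => g • x)) {u f : M → ℝ}
    (hu : MDifferentiableAt 𝓘(ℝ, E) 𝓘(ℝ, ℝ) u (g • x))
    (hf : MDifferentiableAt 𝓘(ℝ, E) 𝓘(ℝ, ℝ) f (g • x)) :
    P.bracket (fun x => u (g • x)) (fun x => f (g • x)) x = P.bracket u f (g • x) := by
  have hs := mdifferentiable_smul (EG := EG) (E := E) (M := M) g x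
  have h := hP x (mvfderiv 𝓘(ℝ, E) u (g • x)) (mvfderiv 𝓘(ℝ, E) f (g • x))
  rw [← mvfderiv_comp x hu hs, ← mvfderiv_comp x hf hs] at h
  exact h.symm

variable [CompactSpace G] [ContMDiffSMul 𝓘(ℝ, EG) 𝓘(ℝ, E) ∞ G M]

theorem SmoothNear.contMDiffAt_smul {u : M → ℝ} (hu : SmoothNear E u m)
    (hm : ∀ g : G, g • m = m) : ∀ᶠ x in 𝓝 m, ∀ g : G,
      ContMDiffAt (𝓘(ℝ, EG).prod 𝓘(ℝ, E)) 𝓘(ℝ, ℝ) ∞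
        (Function.uncurry fun (g : G) (x : M) => u (g • x)) (g, x) := by
  have := ContMDiffSMul.continuousSMul (I := 𝓘(ℝ, EG)) (I' := 𝓘(ℝ, E)) (G := G) (M := M) ∞
  filter_upwards [eventually_forall_smul hm hu] with x hx g
  exact ContMDiffAt.comp (g := u) (f := fun w : G × M => w.1 • w.2) (g, x) (hx g)
    (contMDiff_smul (I := 𝓘(ℝ, EG)) (I' := 𝓘(ℝ, E)) (n := ∞) (G := G) (M := M)).contMDiffAt

variable [LieGroup 𝓘(ℝ, EG) ∞ G]

theorem SmoothNear.contMDiffAt_inv_smul {u : M → ℝ} (hu : SmoothNear E u m)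
    (hm : ∀ g : G, g • m = m) : ∀ᶠ x in 𝓝 m, ∀ g : G,
      ContMDiffAt (𝓘(ℝ, EG).prod 𝓘(ℝ, E)) 𝓘(ℝ, ℝ) ∞
        (Function.uncurry fun (g : G) (x : M) => u (g⁻¹ • x)) (g, x) := by
  filter_upwards [hu.contMDiffAt_smul (EG := EG) hm] with x hx g
  have hinv := (contMDiff_inv 𝓘(ℝ, EG) ∞ (G := G)).contMDiffAt (x := g)
  exact ContMDiffAt.comp (g := Function.uncurry fun (g : G) (x : M) => u (g • x))
    (f := fun w : G × M => (w.1⁻¹, w.2)) (g, x) (hx g⁻¹)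
    ((hinv.comp (g, x) contMDiffAt_fst).prodMk contMDiffAt_snd)

variable [MeasurableSpace G] [BorelSpace G] (μ : Measure G) [IsManifold 𝓘(ℝ, E) ∞ M]
  [FiniteDimensional ℝ E]

/-- The average over `G`, with weight `B`, of the translates of `u`. -/
noncomputable def weightedAverage (B : G → ℝ) (u : M → ℝ) (x : M) : ℝ :=
  ∫ g, B g * u (g⁻¹ • x) ∂μ

variable [IsFiniteMeasure μ] {B : G → ℝ} {u f : M → ℝ}

theorem weightedAverage_spec (hB : ContMDiff 𝓘(ℝ, EG) 𝓘(ℝ, ℝ) ∞ B) (hu : SmoothNear E u m)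
    (hm : ∀ g : G, g • m = m) : SmoothNear E (weightedAverage μ B u) m ∧
      ∀ᶠ x in 𝓝 m, ∀ v : TangentSpace 𝓘(ℝ, E) x,
        mvfderiv 𝓘(ℝ, E) (weightedAverage μ B u) x v =
          ∫ g, B g * mvfderiv 𝓘(ℝ, E) (fun y => u (g⁻¹ • y)) x v ∂μ := by
  have h := hu.contMDiffAt_inv_smul (EG := EG) hm
  have h1 : ∀ᶠ x in 𝓝 m, ∀ g, ContMDiffAt (𝓘(ℝ, EG).prod 𝓘(ℝ, E)) 𝓘(ℝ, ℝ) ∞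
      (Function.uncurry fun (g : G) (x : M) => B g * u (g⁻¹ • x)) (g, x) := by
    filter_upwards [h] with x hx g
    exact ((hB.contMDiffAt (x := g)).comp (g, x) contMDiffAt_fst).mul (hx g)
  have h2 := contMDiffAt_integral_param μ h1
  refine ⟨h2.mono fun x hx => hx.1, ?_⟩
  filter_upwards [h2, h] with x hx hxu v
  refine (hx.2 v).trans (integral_congr_ae (Eventually.of_forall fun g => ?_))
  have hd : ContMDiffAt 𝓘(ℝ, E) 𝓘(ℝ, ℝ) ∞ (fun y => u (g⁻¹ • y)) x :=
    (hxu g).comp x (contMDiffAt_const.prodMk contMDiffAt_id)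
  simp only [mvfderiv_const_mul (B g) (hd.mdifferentiableAt (by simp))]
  rfl

/-- As f is invariant and each g preserves Π, every translate of u has the same bracket c with f
near m. Integration only contributes the total weight. -/
theorem bracket_weightedAverage (P : PoissonStructure E M)
    (hP : ∀ g : G, P.IsPreservedBy (fun x : M => g • x)) (hm : ∀ g : G, g • m = m)
    (hB : ContMDiff 𝓘(ℝ, EG) 𝓘(ℝ, ℝ) ∞ B) (hu : SmoothNear E u m) (hf : SmoothNear E f m)
    (hinv : ∀ᶠ x in 𝓝 m, ∀ g : G, f (g • x) = f x) {c : ℝ}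
    (hc : ∀ᶠ x in 𝓝 m, P.bracket u f x = c) :
    ∀ᶠ x in 𝓝 m, P.bracket (weightedAverage μ B u) f x = (∫ g, B g ∂μ) * c := by
  have := ContMDiffSMul.continuousSMul (I := 𝓘(ℝ, EG)) (I' := 𝓘(ℝ, E)) (G := G) (M := M) ∞
  filter_upwards [(weightedAverage_spec μ hB hu hm).2, hinv.eventually_nhds,
    eventually_forall_smul hm (hu.eventually.and (hf.eventually.and hc))] with x hx hxi hxs
  rw [P.bracket_eq_mvfderiv, hx, ← integral_mul_const]
  refine integral_congr_ae (Eventually.of_forall fun g => ?_)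
  have h1 := P.bracket_comp_smul (EG := EG) (x := x) (hP g⁻¹) (hxs g⁻¹).1.mdifferentiableAt
    (hxs g⁻¹).2.1.mdifferentiableAt
  have h2 : (fun y => f (g⁻¹ • y)) =ᶠ[𝓝 x] f := hxi.mono fun y hy => hy g⁻¹
  rw [P.bracket_congr_right h2, (hxs g⁻¹).2.2] at h1
  exact congrArg (B g * ·) h1

end Action

/-! ### Dual bases and Haar measure -/

section LinearAlgebra

variable {F : Type*} [NormedAddCommGroup F] [NormedSpace ℝ F] [FiniteDimensional ℝ F]
  {ι : Type*} {w : ι → F}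

theorem LinearIndependent.exists_clm_apply_eq (hw : LinearIndependent ℝ w) (c : ι → ℝ) :
    ∃ l : F →L[ℝ] ℝ, ∀ i, l (w i) = c i := by
  obtain ⟨g, hg⟩ := ((Module.Basis.span hw).constr ℝ c).exists_extend
  refine ⟨LinearMap.toContinuousLinearMap g, fun i => ?_⟩
  have h := congrArg (fun A : Submodule.span ℝ (range w) →ₗ[ℝ] ℝ => A (Module.Basis.span hw i)) hg
  rw [LinearMap.comp_apply, Module.Basis.constr_basis] at h
  simpa [Module.Basis.span_apply] using h

/-- Independent vectors have a dual description: a basis `l` of their annihilator, together with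
vectors `e` dual to it. -/
theorem LinearIndependent.exists_annihilator_basis [Fintype ι] (hw : LinearIndependent ℝ w) {s : ℕ}
    (hdim : Module.finrank ℝ F = Fintype.card ι + s) :
    ∃ (l : Fin s → F →L[ℝ] ℝ) (e : Fin s → F), (∀ j i, l j (w i) = 0) ∧
      (∀ i j, l i (e j) = if i = j then 1 else 0) ∧
      (∀ D : F →L[ℝ] ℝ, (∀ i, D (w i) = 0) → ∀ v, D v = ∑ j, D (e j) * l j v) ∧
      ∀ v, (∀ j, l j v = 0) → v ∈ Submodule.span ℝ (range w) := by
  set N := Submodule.span ℝ (range w)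
  have hN : Module.finrank ℝ N = Fintype.card ι := finrank_span_eq_card hw
  have hs : Module.finrank ℝ (F ⧸ N) = s := by
    have := N.finrank_quotient_add_finrank
    omega
  -- The annihilator of N is the dual of F ⧸ N: a basis of the quotient supplies `l` as its
  -- coordinates and `e` as lifts of its members.
  let b := Module.finBasisOfFinrankEq ℝ (F ⧸ N) hs
  have hsurj := N.mkQ_surjective
  choose e he using fun j => hsurj (b j)
  have hl0 : ∀ v, (∀ j, b.coord j (N.mkQ v) = 0) → v ∈ N := fun v hv => by
    rw [← Submodule.Quotient.mk_eq_zero N]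
    exact b.forall_coord_eq_zero_iff.1 hv
  have hlw : ∀ v ∈ N, N.mkQ v = 0 := fun v hv => (Submodule.Quotient.mk_eq_zero N).2 hv
  refine ⟨fun j => LinearMap.toContinuousLinearMap ((b.coord j).comp N.mkQ), e, ?_, ?_, ?_, hl0⟩
  · intro j i
    have := hlw (w i) (Submodule.subset_span (mem_range_self i))
    simpa using congrArg (b.coord j) this
  · intro i j
    change b.coord i (N.mkQ (e j)) = _
    rw [he, b.coord_apply, b.repr_self, Finsupp.single_apply]
    simp [eq_comm]
  · intro D hD v
    have hDN : ∀ v ∈ N, D v = 0 := fun v hv => by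
      have : N ≤ D.ker := Submodule.span_le.2 (by rintro _ ⟨i, rfl⟩; exact hD i)
      exact this hv
    have hmem : v - ∑ j, b.coord j (N.mkQ v) • e j ∈ N := by
      refine hl0 _ fun i => ?_
      rw [map_sub, map_sum]
      simp only [map_smul, he]
      rw [show ∑ j, b.coord j (N.mkQ v) • b j = N.mkQ v from b.sum_repr _, sub_self, map_zero]
    have h := hDN _ hmem
    rw [map_sub, map_sum, sub_eq_zero] at h
    rw [h]
    refine Finset.sum_congr rfl fun j _ => ?_
    rw [map_smul, smul_eq_mul, mul_comm]
    rfl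

end LinearAlgebra

theorem exists_isProbabilityMeasure_isMulLeftInvariant (G : Type*) [Group G] [TopologicalSpace G]
    [IsTopologicalGroup G] [CompactSpace G] [MeasurableSpace G] [BorelSpace G] :
    ∃ μ : Measure G, IsProbabilityMeasure μ ∧ μ.IsMulLeftInvariant := by
  let K : TopologicalSpace.PositiveCompacts G := ⊤
  exact ⟨Measure.haarMeasure K, ⟨Measure.haarMeasure_self (K₀ := K)⟩, inferInstance⟩

/-! ### Invariant conjugate functions -/

section Equivariant

variable {E M : Type*} [NormedAddCommGroup E] [NormedSpace ℝ E] [FiniteDimensional ℝ E]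
  [TopologicalSpace M] [ChartedSpace E M] [IsManifold 𝓘(ℝ, E) ∞ M]
  {EG : Type*} [NormedAddCommGroup EG] [NormedSpace ℝ EG]
  {G : Type*} [Group G] [TopologicalSpace G] [CompactSpace G] [ChartedSpace EG G]
  [LieGroup 𝓘(ℝ, EG) ∞ G] [MulAction G M] [ContMDiffSMul 𝓘(ℝ, EG) 𝓘(ℝ, E) ∞ G M]
  (P : PoissonStructure E M) {m : M}

include EG in
/-- An invariant function with prescribed constant brackets with given invariant functions. -/
theorem exists_invariant_bracket_eq_const
    (hP : ∀ g : G, P.IsPreservedBy (fun x : M => g • x)) (hm : ∀ g : G, g • m = m)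
    {ι : Type*} [Finite ι] {f : ι → M → ℝ} (hf : ∀ i, SmoothNear E (f i) m)
    (hinv : ∀ i, ∀ᶠ x in 𝓝 m, ∀ g : G, f i (g • x) = f i x)
    (hbr : ∀ i j, ∃ c, ∀ᶠ x in 𝓝 m, P.bracket (f i) (f j) x = c)
    (hind : LinearIndependent ℝ fun i => P.hamiltonian (f i) m) (c : ι → ℝ) :
    ∃ q : M → ℝ, SmoothNear E q m ∧ q m = 0 ∧ (∀ (g : G) x, q (g • x) = q x) ∧
      ∀ i, ∀ᶠ x in 𝓝 m, P.bracket q (f i) x = c i := by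
  have := topologicalGroup_of_lieGroup 𝓘(ℝ, EG) ∞ (G := G)
  let _ : MeasurableSpace G := borel G
  have : BorelSpace G := ⟨rfl⟩
  obtain ⟨μ, hμ, hμ'⟩ := exists_isProbabilityMeasure_isMulLeftInvariant G
  obtain ⟨l, hl⟩ := LinearIndependent.exists_clm_apply_eq (F := E) hind c
  obtain ⟨u, hu, -, hub⟩ := P.exists_bracket_eq_const hf hbr hind l
  have hB : ContMDiff 𝓘(ℝ, EG) 𝓘(ℝ, ℝ) ∞ (fun _ : G => (1 : ℝ)) := contMDiff_const
  let q₀ := weightedAverage μ (fun _ : G => (1 : ℝ)) u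
  have hq₀ : SmoothNear E q₀ m := (weightedAverage_spec μ hB hu hm).1
  -- By left invariance of μ, h may be replaced by g h, which turns h⁻¹ g x into h⁻¹ x.
  have hq₀inv : ∀ (g : G) x, q₀ (g • x) = q₀ x := fun g x => by
    have := integral_mul_left_eq_self (μ := μ) (fun h : G => (1 : ℝ) * u (h⁻¹ • g • x)) g
    simp only [q₀, weightedAverage]
    rw [← this]
    simp [mul_inv_rev, mul_smul]
  refine ⟨fun x => q₀ x - q₀ m, hq₀.sub_const _, sub_self _, fun g x => by simp [hq₀inv],
    fun i => ?_⟩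
  filter_upwards [bracket_weightedAverage μ P hP hm hB hu (hf i) (hinv i) (hub i),
    hq₀.eventually] with x hx hxq
  have h1 : ∫ _ : G, (1 : ℝ) ∂μ = 1 := by simp
  rw [P.bracket_sub_const _ hxq.mdifferentiableAt, hx, h1, one_mul]
  exact hl i

omit [FiniteDimensional ℝ E] [IsManifold 𝓘(ℝ, E) ∞ M] in
-- Pairing a linear relation with the differential of p_{σ' i} kills the p-part, by involution, and
-- isolates the coefficient of q_i up to sign. The map `σ'` allows for only some of the p_i having a
-- conjugate yet, as happens during the induction that constructs the q_i.
theorem PoissonStructure.linearIndependent_hamiltonian_sumElim {r : ℕ} {κ : Type*} [Fintype κ]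
    {p : Fin r → M → ℝ} {q : κ → M → ℝ} {σ' : κ → Fin r} (hσ : Function.Injective σ')
    (hpp : ∀ i j, P.bracket (p i) (p j) m = 0)
    (hqp : ∀ i j, P.bracket (q i) (p j) m = if σ' i = j then 1 else 0)
    (hind : LinearIndependent ℝ fun i => P.hamiltonian (p i) m) :
    LinearIndependent ℝ fun i => P.hamiltonian (Sum.elim p q i) m := by
  classical
  refine Fintype.linearIndependent_iff.2 fun a ha => ?_
  rw [Fintype.sum_sum_type] at ha
  simp only [Sum.elim_inl, Sum.elim_inr] at ha
  have hb : ∀ i, a (Sum.inr i) = 0 := fun i => by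
    have h := congrArg (mvfderiv 𝓘(ℝ, E) (p (σ' i)) m) ha
    rw [map_add, map_sum, map_sum, map_zero] at h
    simp only [map_smul, ← P.bracket_eq_mvfderiv, hpp, smul_zero, Finset.sum_const_zero,
      zero_add] at h
    have h' : ∀ j, P.bracket (p (σ' i)) (q j) m = if j = i then -1 else 0 := fun j => by
      rw [P.bracket_swap, hqp]
      by_cases hij : j = i
      · simp [hij]
      · simp [hij, hσ.ne hij]
    simpa [h'] using h
  simp only [hb, zero_smul, Finset.sum_const_zero, add_zero] at ha
  rintro (i | i)
  · exact Fintype.linearIndependent_iff.1 hind (fun i => a (Sum.inl i)) ha i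
  · exact hb i

include EG in
/-- Invariant functions in involution with independent Hamiltonian vector fields have invariant
conjugate functions which are in involution. -/
theorem exists_invariant_conjugate
    (hP : ∀ g : G, P.IsPreservedBy (fun x : M => g • x)) (hm : ∀ g : G, g • m = m)
    {r : ℕ} {p : Fin r → M → ℝ} (hp : ∀ i, SmoothNear E (p i) m)
    (hinv : ∀ i, ∀ᶠ x in 𝓝 m, ∀ g : G, p i (g • x) = p i x)
    (hpp : ∀ i j, ∀ᶠ x in 𝓝 m, P.bracket (p i) (p j) x = 0)
    (hind : LinearIndependent ℝ fun i => P.hamiltonian (p i) m) :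
    ∃ q : Fin r → M → ℝ, (∀ i, SmoothNear E (q i) m) ∧ (∀ i, q i m = 0) ∧
      (∀ i (g : G) x, q i (g • x) = q i x) ∧
      (∀ i j, ∀ᶠ x in 𝓝 m, P.bracket (q i) (p j) x = if i = j then 1 else 0) ∧
      ∀ i j, ∀ᶠ x in 𝓝 m, P.bracket (q i) (q j) x = 0 := by
  classical
  -- Conjugates are adjoined one at a time because each must commute with those already chosen. The
  -- p_j together with the q_i for i in S have constant brackets, so the new function can be given
  -- bracket δ_{aj} with p_j and 0 with the old q_i.
  have key : ∀ S : Finset (Fin r), ∃ q : Fin r → M → ℝ,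
      (∀ i ∈ S, SmoothNear E (q i) m ∧ q i m = 0 ∧ (∀ (g : G) x, q i (g • x) = q i x) ∧
        ∀ j, ∀ᶠ x in 𝓝 m, P.bracket (q i) (p j) x = if i = j then 1 else 0) ∧
      ∀ i ∈ S, ∀ j ∈ S, ∀ᶠ x in 𝓝 m, P.bracket (q i) (q j) x = 0 := by
    intro S
    induction S using Finset.induction_on with
    | empty => exact ⟨fun _ _ => 0, by simp⟩
    | insert a S ha ih =>
      obtain ⟨q, hq, hqq⟩ := ih
      let f : Fin r ⊕ S → M → ℝ := Sum.elim p fun i : S => q i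
      have hpq : ∀ (i : Fin r) (j : S), ∀ᶠ x in 𝓝 m,
          P.bracket (p i) (q j) x = -(if (j : Fin r) = i then 1 else 0) := fun i j => by
        filter_upwards [(hq j j.2).2.2.2 i] with x hx
        rw [P.bracket_swap, hx]
      obtain ⟨u, hu, hu0, huinv, huf⟩ := exists_invariant_bracket_eq_const (EG := EG) (G := G)
        P hP hm (f := f)
        (by rintro (i | i); exacts [hp i, (hq i i.2).1])
        (by rintro (i | i)
            exacts [hinv i, Eventually.of_forall fun x g => (hq i i.2).2.2.1 g x])
        (by rintro (i | i) (j | j)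
            exacts [⟨0, hpp i j⟩, ⟨_, hpq i j⟩, ⟨_, (hq i i.2).2.2.2 j⟩, ⟨0, hqq i i.2 j j.2⟩])
        (P.linearIndependent_hamiltonian_sumElim (σ' := ((↑) : S → Fin r))
          Subtype.val_injective (fun i j => (hpp i j).self_of_nhds)
          (fun i j => ((hq i i.2).2.2.2 j).self_of_nhds) hind)
        (Sum.elim (fun j => if a = j then 1 else 0) fun _ => 0)
      have hne : ∀ i ∈ S, i ≠ a := fun i hi h => ha (h ▸ hi)
      refine ⟨Function.update q a u, fun i hi => ?_, fun i hi j hj => ?_⟩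
      · rcases Finset.mem_insert.1 hi with rfl | hi
        · rw [Function.update_self]
          exact ⟨hu, hu0, huinv, fun j => huf (Sum.inl j)⟩
        · rw [Function.update_of_ne (hne i hi)]
          exact hq i hi
      · rcases Finset.mem_insert.1 hi with rfl | hi' <;>
          rcases Finset.mem_insert.1 hj with rfl | hj'
        · exact Eventually.of_forall fun x => P.bracket_self
        · rw [Function.update_self, Function.update_of_ne (hne j hj')]
          exact huf (Sum.inr ⟨j, hj'⟩)
        · rw [Function.update_self, Function.update_of_ne (hne i hi')]
          filter_upwards [huf (Sum.inr ⟨i, hi'⟩)] with x hx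
          rw [P.bracket_swap]
          exact neg_eq_zero.2 hx
        · rw [Function.update_of_ne (hne i hi'), Function.update_of_ne (hne j hj')]
          exact hqq i hi' j hj'
  obtain ⟨q, hq, hqq⟩ := key Finset.univ
  exact ⟨q, fun i => (hq i (Finset.mem_univ i)).1, fun i => (hq i (Finset.mem_univ i)).2.1,
    fun i => (hq i (Finset.mem_univ i)).2.2.1, fun i => (hq i (Finset.mem_univ i)).2.2.2,
    fun i j => hqq i (Finset.mem_univ i) j (Finset.mem_univ j)⟩

end Equivariant

/-! ### Linearizing the action on transverse functions -/

section Transverse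

variable {E M : Type*} [NormedAddCommGroup E] [NormedSpace ℝ E] [FiniteDimensional ℝ E]
  [TopologicalSpace M] [ChartedSpace E M] [IsManifold 𝓘(ℝ, E) ∞ M]
  {EG : Type*} [NormedAddCommGroup EG] [NormedSpace ℝ EG]
  {G : Type*} [Group G] [TopologicalSpace G] [CompactSpace G] [ChartedSpace EG G]
  [LieGroup 𝓘(ℝ, EG) ∞ G] [MulAction G M] [ContMDiffSMul 𝓘(ℝ, EG) 𝓘(ℝ, E) ∞ G M]
  (P : PoissonStructure E M) {m : M}

omit [FiniteDimensional ℝ E] [IsManifold 𝓘(ℝ, E) ∞ M] [CompactSpace G]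
  [LieGroup 𝓘(ℝ, EG) ∞ G] in
include EG in
/-- The matrix representation of `G` on the differentials at a fixed point of functions `z`, when
the span of these differentials is invariant. -/
theorem exists_monoidHom_of_mvfderiv (hm : ∀ g : G, g • m = m) {s : ℕ} {z : Fin s → M → ℝ}
    (hz : ∀ j, MDifferentiableAt 𝓘(ℝ, E) 𝓘(ℝ, ℝ) (z j) m) {e : Fin s → TangentSpace 𝓘(ℝ, E) m}
    (hze : ∀ i j, mvfderiv 𝓘(ℝ, E) (z i) m (e j) = if i = j then 1 else 0)
    (hspan : ∀ (g : G) i v, mvfderiv 𝓘(ℝ, E) (fun x => z i (g • x)) m v =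
      ∑ j, mvfderiv 𝓘(ℝ, E) (fun x => z i (g • x)) m (e j) * mvfderiv 𝓘(ℝ, E) (z j) m v) :
    ∃ A : G →* Matrix (Fin s) (Fin s) ℝ,
      ∀ g i j, A g i j = mvfderiv 𝓘(ℝ, E) (fun x => z i (g • x)) m (e j) := by
  refine ⟨{ toFun := fun g => Matrix.of fun i j =>
              mvfderiv 𝓘(ℝ, E) (fun x => z i (g • x)) m (e j)
            map_one' := ?_
            map_mul' := ?_ }, fun g i j => rfl⟩
  · ext i j
    simp [hze, Matrix.one_apply]
  · intro g h
    ext i k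
    have hzg : ∀ (g : G) i, MDifferentiableAt 𝓘(ℝ, E) 𝓘(ℝ, ℝ) (fun x => z i (g • x)) m :=
      fun g i => by
        have h1 : MDifferentiableAt 𝓘(ℝ, E) 𝓘(ℝ, ℝ) (z i) (g • m) := by rw [hm]; exact hz i
        exact h1.comp m (mdifferentiable_smul (EG := EG) (E := E) (M := M) g m)
    have hmul : ∀ {u : M → ℝ} (c : ℝ), MDifferentiableAt 𝓘(ℝ, E) 𝓘(ℝ, ℝ) u m →
        MDifferentiableAt 𝓘(ℝ, E) 𝓘(ℝ, ℝ) (fun x => c * u x) m := fun c hu =>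
      mdifferentiableAt_const.mul hu
    let a : Fin s → ℝ := fun j => mvfderiv 𝓘(ℝ, E) (fun x => z i (g • x)) m (e j)
    have hsum := mvfderiv_sum (s := Finset.univ) (fun j => hmul (a j) (hz j))
    have hsum' := mvfderiv_sum (s := Finset.univ) (fun j => hmul (a j) (hzg h j))
    have h1 : mvfderiv 𝓘(ℝ, E) (fun x => z i (g • x)) m =
        mvfderiv 𝓘(ℝ, E) (fun x => ∑ j, a j * z j x) m := by
      ext v
      rw [hsum.2, hspan g i v, _root_.sum_apply]
      refine Finset.sum_congr rfl fun j _ => ?_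
      rw [mvfderiv_const_mul _ (hz j)]
      rfl
    -- z_i ∘ g and ∑ a_j z_j agree to first order at the fixed point, hence also after composition
    -- with h. This gives A(gh) = A(g) A(h).
    have h2 := mvfderiv_comp_smul_congr (EG := EG) (hm h) (hzg g i) hsum.1 h1
    simp only [← mul_smul] at h2
    rw [Matrix.mul_apply]
    simp only [Matrix.of_apply]
    rw [h2, hsum'.2, _root_.sum_apply]
    refine Finset.sum_congr rfl fun j _ => ?_
    rw [mvfderiv_const_mul _ (hzg h j)]
    rfl

include EG in
/-- Given invariant functions `f i` with constant brackets and independent Hamiltonian vector fields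
at a fixed point, there are functions `z j` commuting with them, whose differentials span the
annihilator of the Hamiltonian vector fields, and which span a finite-dimensional representation. -/
theorem exists_equivariant_transverse
    (hP : ∀ g : G, P.IsPreservedBy (fun x : M => g • x)) (hm : ∀ g : G, g • m = m)
    {ι : Type*} [Fintype ι] {f : ι → M → ℝ} (hf : ∀ i, SmoothNear E (f i) m)
    (hinv : ∀ i, ∀ᶠ x in 𝓝 m, ∀ g : G, f i (g • x) = f i x)
    (hbr : ∀ i j, ∃ c, ∀ᶠ x in 𝓝 m, P.bracket (f i) (f j) x = c)
    (hind : LinearIndependent ℝ fun i => P.hamiltonian (f i) m) {s : ℕ}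
    (hdim : Module.finrank ℝ E = Fintype.card ι + s) :
    ∃ (z : Fin s → M → ℝ) (A : G →* Matrix (Fin s) (Fin s) ℝ),
      (∀ j, SmoothNear E (z j) m) ∧ (∀ j, z j m = 0) ∧
      (∀ j i, ∀ᶠ x in 𝓝 m, P.bracket (z j) (f i) x = 0) ∧
      (∀ i j, Continuous fun g => A g i j) ∧
      (∀ᶠ x in 𝓝 m, ∀ g : G, (fun j => z j (g • x)) = A g *ᵥ fun j => z j x) ∧
      ∀ v : TangentSpace 𝓘(ℝ, E) m, (∀ j, mvfderiv 𝓘(ℝ, E) (z j) m v = 0) →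
        v ∈ Submodule.span ℝ (range fun i => P.hamiltonian (f i) m) := by
  have := topologicalGroup_of_lieGroup 𝓘(ℝ, EG) ∞ (G := G)
  let _ : MeasurableSpace G := borel G
  have : BorelSpace G := ⟨rfl⟩
  obtain ⟨μ, hμ, hμ'⟩ := exists_isProbabilityMeasure_isMulLeftInvariant G
  obtain ⟨l, e, hlf, hle, hspan, hker⟩ :=
    LinearIndependent.exists_annihilator_basis (F := E) hind hdim
  choose u hu hul huf using fun j => P.exists_bracket_eq_const hf hbr hind (l j)
  let z : Fin s → M → ℝ := fun j x => u j x - u j m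
  have hz : ∀ j, SmoothNear E (z j) m := fun j => (hu j).sub_const _
  have hzl : ∀ j, mvfderiv 𝓘(ℝ, E) (z j) m = l j := fun j => by
    rw [mvfderiv_sub_const _ (hu j).mdifferentiableAt, hul]
  have hzf : ∀ j i, ∀ᶠ x in 𝓝 m, P.bracket (z j) (f i) x = 0 := fun j i => by
    filter_upwards [huf j i, (hu j).eventually] with x hx hxs
    rw [P.bracket_sub_const _ hxs.mdifferentiableAt, hx]
    exact hlf j i
  -- The differential of z_i ∘ g annihilates every X_{f_k}: since f_k is invariant, {z_i ∘ g, f_k} =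
  -- {z_i, f_k} ∘ g, which vanishes at m. It is therefore a combination of the l_j.
  have hspan' : ∀ (g : G) i v, mvfderiv 𝓘(ℝ, E) (fun x => z i (g • x)) m v =
      ∑ j, mvfderiv 𝓘(ℝ, E) (fun x => z i (g • x)) m (e j) * mvfderiv 𝓘(ℝ, E) (z j) m v := by
    intro g i v
    simp only [hzl]
    refine hspan (mvfderiv 𝓘(ℝ, E) (fun x => z i (g • x)) m) (fun k => ?_) v
    have h1 := P.bracket_comp_smul (EG := EG) (x := m) (hP g)
      (u := z i) (f := f k) (by rw [hm]; exact (hz i).mdifferentiableAt)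
      (by rw [hm]; exact (hf k).mdifferentiableAt)
    have h2 : (fun y => f k (g • y)) =ᶠ[𝓝 m] f k := (hinv k).mono fun y hy => hy g
    rw [P.bracket_congr_right h2, hm, (hzf i k).self_of_nhds] at h1
    exact h1
  obtain ⟨A, hA⟩ := exists_monoidHom_of_mvfderiv (EG := EG) hm (fun j => (hz j).mdifferentiableAt)
    (e := e) (fun i j => by rw [hzl]; exact hle i j) hspan'
  have hAs : ∀ i j, ContMDiff 𝓘(ℝ, EG) 𝓘(ℝ, ℝ) ∞ fun g => A g i j := fun i j => by
    simp only [hA]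
    exact contMDiff_mvfderiv_param (F := fun (g : G) x => z i (g • x))
      ((hz i).contMDiffAt_smul (EG := EG) hm).self_of_nhds (e j)
  -- Bochner's linearization: summed over j, these are the components of ∫ A(g) z(g⁻¹x) dμ. It is
  -- equivariant by left invariance, and its differential at m is ∫ A(g) A(g⁻¹) dz = dz, so
  -- independence is kept.
  let Z : Fin s → Fin s → M → ℝ := fun i j => weightedAverage μ (fun g => A g i j) (z j)
  have hZ : ∀ i j, SmoothNear E (Z i j) m := fun i j =>
    (weightedAverage_spec μ (hAs i j) (hz j) hm).1
  have hZd : ∀ i v, mvfderiv 𝓘(ℝ, E) (fun x => ∑ j, Z i j x) m v = l i v := by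
    intro i v
    rw [(mvfderiv_sum fun j => (hZ i j).mdifferentiableAt).2, _root_.sum_apply]
    have h1 : ∀ j, mvfderiv 𝓘(ℝ, E) (Z i j) m v = ∫ g, A g i j * (A g⁻¹ *ᵥ fun k => l k v) j ∂μ :=
      fun j => by
        rw [(weightedAverage_spec μ (hAs i j) (hz j) hm).2.self_of_nhds]
        refine integral_congr_ae (Eventually.of_forall fun g => ?_)
        simp only [hspan' g⁻¹ j v, Matrix.mulVec, dotProduct, hA, hzl]
        rfl
    simp only [h1]
    rw [← integral_finsetSum]
    · have h2 : ∀ g, ∑ j, A g i j * (A g⁻¹ *ᵥ fun k => l k v) j = l i v := fun g => by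
        change (A g *ᵥ (A g⁻¹ *ᵥ fun k => l k v)) i = _
        rw [Matrix.mulVec_mulVec, ← map_mul, mul_inv_cancel, map_one, Matrix.one_mulVec]
      simp only [h2]
      simp
    · intro j _
      refine Continuous.integrable_of_compactSpace μ ((hAs i j).continuous.mul ?_)
      simp only [Matrix.mulVec, dotProduct]
      refine continuous_finsetSum _ fun k _ => ?_
      exact (((hAs j k).continuous).comp continuous_inv).mul continuous_const
  refine ⟨fun i x => ∑ j, Z i j x, A, fun i => SmoothNear.sum (hZ i), fun i => ?_, fun i k => ?_,
    fun i j => (hAs i j).continuous, ?_, fun v hv => hker v fun j => by rw [← hZd]; exact hv j⟩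
  · refine Finset.sum_eq_zero fun j _ => ?_
    simp [Z, weightedAverage, hm, z]
  · filter_upwards [eventually_all.2 fun j => bracket_weightedAverage μ P hP hm (hAs i j) (hz j)
      (hf k) (hinv k) (hzf j k), eventually_all.2 fun j => (hZ i j).eventually] with x hx hxs
    rw [P.bracket_eq_mvfderiv, (mvfderiv_sum fun j => (hxs j).mdifferentiableAt).2,
      _root_.sum_apply]
    refine Finset.sum_eq_zero fun j _ => ?_
    rw [← P.bracket_eq_mvfderiv, hx j, mul_zero]
  · filter_upwards [eventually_all.2 fun j => (hz j).contMDiffAt_inv_smul (EG := EG) (G := G) hm]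
      with x hx h
    have hint : ∀ k j, Integrable (fun g => A g k j * z j (g⁻¹ • x)) μ := fun k j => by
      refine Continuous.integrable_of_compactSpace μ ((hAs k j).continuous.mul ?_)
      exact continuous_iff_continuousAt.2 fun g =>
        ContinuousAt.comp (g := Function.uncurry fun (g : G) (x : M) => z j (g⁻¹ • x))
          (f := fun g : G => (g, x)) (hx j g).continuousAt (by fun_prop)
    funext i
    simp only [Matrix.mulVec, dotProduct, Finset.mul_sum]
    rw [Finset.sum_comm]
    refine Finset.sum_congr rfl fun j _ => ?_
    simp only [Z, weightedAverage]
    rw [← integral_mul_left_eq_self (μ := μ) (fun g : G => A g i j * z j (g⁻¹ • h • x)) h]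
    simp only [← integral_const_mul]
    rw [← integral_finsetSum _ fun k _ => (hint k j).const_mul _]
    refine integral_congr_ae (Eventually.of_forall fun g => ?_)
    simp only [map_mul, Matrix.mul_apply, mul_inv_rev, ← mul_smul, inv_mul_cancel, mul_one,
      Finset.sum_mul, mul_assoc]

end Transverse

/-! ### Charts from maps with injective differential -/

section SmoothChart

variable {E M F : Type*} [NormedAddCommGroup E] [NormedSpace ℝ E]
  [TopologicalSpace M] [ChartedSpace E M] [NormedAddCommGroup F] [NormedSpace ℝ F]

theorem mvfderiv_clm_comp (l : F →L[ℝ] ℝ) {Φ : M → F} {x : M}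
    (hΦ : MDifferentiableAt 𝓘(ℝ, E) 𝓘(ℝ, F) Φ x) (v : TangentSpace 𝓘(ℝ, E) x) :
    mvfderiv 𝓘(ℝ, E) (fun y => l (Φ y)) x v = l (mfderiv 𝓘(ℝ, E) 𝓘(ℝ, F) Φ x v) := by
  have h := mvfderiv_comp_apply x (mdifferentiableAt_iff_differentiableAt.2
    (l.differentiableAt (x := Φ x))) hΦ v
  refine h.trans ?_
  exact congrArg (fun A : F →L[ℝ] ℝ => A (mfderiv 𝓘(ℝ, E) 𝓘(ℝ, F) Φ x v))
    (mfderiv_eq_fderiv.trans l.fderiv)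

/-- A map which is smooth near `m`, with injective differential at `m` between spaces of the same
dimension, restricts to a smooth chart around `m`. -/
theorem exists_isSmoothChart_of_mfderiv_injective [FiniteDimensional ℝ E] [FiniteDimensional ℝ F]
    [IsManifold 𝓘(ℝ, E) ∞ M] (hdim : Module.finrank ℝ E = Module.finrank ℝ F) {Φ : M → F} {m : M}
    (hΦ : ∀ᶠ x in 𝓝 m, ContMDiffAt 𝓘(ℝ, E) 𝓘(ℝ, F) ∞ Φ x)
    (hinj : ∀ v, mfderiv 𝓘(ℝ, E) 𝓘(ℝ, F) Φ m v = 0 → v = 0) :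
    ∃ φ : OpenPartialHomeomorph M F, m ∈ φ.source ∧ IsSmoothChart E φ ∧
      ∀ x ∈ φ.source, φ x = Φ x := by
  have := FiniteDimensional.complete ℝ E
  have hχ : IsSmoothChart E (chartAt E m) := isSmoothChart_chartAt m
  set χ := chartAt E m
  have hm : m ∈ χ.source := mem_chart_source E m
  have hm' : χ m ∈ χ.target := χ.map_source hm
  have hsymm : Tendsto χ.symm (𝓝 (χ m)) (𝓝 m) := by
    have := (χ.symm.continuousAt hm').tendsto
    rwa [χ.left_inv hm] at this
  have hsm : ∀ᶠ y in 𝓝 (χ m), ContDiffAt ℝ ∞ (Φ ∘ χ.symm) y := by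
    filter_upwards [χ.open_target.mem_nhds hm', hsymm.eventually hΦ] with y hy hyΦ
    have := (hχ.contMDiffAt_iff (χ.map_target hy)).1 hyΦ
    rwa [χ.right_inv hy] at this
  let D : E →L[ℝ] F := fderiv ℝ (Φ ∘ χ.symm) (χ m)
  have hD : HasFDerivAt (Φ ∘ χ.symm) D (χ m) :=
    (hsm.self_of_nhds.differentiableAt (by simp)).hasFDerivAt
  have hker : D.ker = ⊥ := by
    refine (Submodule.eq_bot_iff _).2 fun w hw => ?_
    have h1 := mfderiv_comp_of_eq (x := χ m) (hΦ.self_of_nhds.mdifferentiableAt (by simp))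
      (hχ.mdifferentiableAt_symm hm') (χ.left_inv hm)
    rw [mfderiv_eq_fderiv] at h1
    have h2 : (mfderiv 𝓘(ℝ, E) 𝓘(ℝ, E) χ.symm (χ m) : E →L[ℝ] E) w = 0 := by
      refine hinj _ ?_
      have h3 : ∀ y, y = m → (mfderiv 𝓘(ℝ, E) 𝓘(ℝ, F) Φ y : E →L[ℝ] F) =
        (mfderiv 𝓘(ℝ, E) 𝓘(ℝ, F) Φ m : E →L[ℝ] F) := by rintro _ rfl; rfl
      rw [← h3 _ (χ.left_inv hm)]
      exact (congrArg (fun A : E →L[ℝ] F => A w) h1).symm.trans hw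
    have h4 := hχ.mfderiv_mfderiv_symm hm w
    rw [← h4]
    refine Eq.trans ?_ (map_zero (mfderiv 𝓘(ℝ, E) 𝓘(ℝ, E) χ m))
    exact congrArg (mfderiv 𝓘(ℝ, E) 𝓘(ℝ, E) χ m : E →L[ℝ] E) h2
  have hrange : D.range = ⊤ :=
    (LinearMap.ker_eq_bot_iff_range_eq_top_of_finrank_eq_finrank hdim).1 hker
  obtain ⟨e, he0, he, hes, hesymm⟩ := exists_openPartialHomeomorph_of_contDiffAt hsm
    (f' := ContinuousLinearEquiv.ofBijective D hker hrange) hD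
  refine ⟨χ.trans e, ?_, ⟨fun {x} hx => ?_, fun {y} hy => ?_⟩, fun x hx => ?_⟩
  · rw [OpenPartialHomeomorph.trans_source]
    exact ⟨hm, he0⟩
  · rw [OpenPartialHomeomorph.trans_source] at hx
    refine ContMDiffAt.comp (g := e) x ?_ (hχ.contMDiffAt hx.1)
    rw [he]
    exact (hes _ hx.2).contMDiffAt
  · rw [OpenPartialHomeomorph.trans_target] at hy
    exact ContMDiffAt.comp (g := χ.symm) y (hχ.contMDiffAt_symm hy.2) (hesymm _ hy.1).contMDiffAt
  · rw [OpenPartialHomeomorph.trans_source] at hx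
    rw [OpenPartialHomeomorph.coe_trans, he]
    simp [χ.left_inv hx.1]

end SmoothChart

/-! ### The Poisson structure in a splitting chart -/

/-- A chart `(p, q, z)` in which `p, q` are conjugate and commute with `z`. -/
structure IsSplittingChart {E M : Type*} [NormedAddCommGroup E] [NormedSpace ℝ E]
    [TopologicalSpace M] [ChartedSpace E M] (P : PoissonStructure E M) {r s : ℕ}
    (φ : OpenPartialHomeomorph M (PQZ r s)) (p q : Fin r → M → ℝ) (z : Fin s → M → ℝ) : Prop where
  chart : IsSmoothChart E φ
  apply : ∀ x ∈ φ.source, φ x = (fun i => p i x, fun i => q i x, fun j => z j x)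
  pp : ∀ x ∈ φ.source, ∀ i j, P.bracket (p i) (p j) x = 0
  qp : ∀ x ∈ φ.source, ∀ i j, P.bracket (q i) (p j) x = if i = j then 1 else 0
  qq : ∀ x ∈ φ.source, ∀ i j, P.bracket (q i) (q j) x = 0
  zp : ∀ x ∈ φ.source, ∀ i j, P.bracket (z i) (p j) x = 0
  zq : ∀ x ∈ φ.source, ∀ i j, P.bracket (z i) (q j) x = 0

namespace IsSplittingChart

variable {E M : Type*} [NormedAddCommGroup E] [NormedSpace ℝ E]
  [TopologicalSpace M] [ChartedSpace E M] {P : PoissonStructure E M} {r s : ℕ}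
  {φ : OpenPartialHomeomorph M (PQZ r s)} {p q : Fin r → M → ℝ} {z : Fin s → M → ℝ}
  (h : IsSplittingChart P φ p q z) {x : M}
include h

theorem mvfderiv_of_eq (l : PQZ r s →L[ℝ] ℝ) {u : M → ℝ} (hu : ∀ y ∈ φ.source, u y = l (φ y))
    (hx : x ∈ φ.source) (v : TangentSpace 𝓘(ℝ, E) x) :
    SmoothNear E u x ∧
    mvfderiv 𝓘(ℝ, E) u x v = l (mfderiv 𝓘(ℝ, E) 𝓘(ℝ, PQZ r s) φ x v) := by
  have hev : u =ᶠ[𝓝 x] fun y => l (φ y) := by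
    filter_upwards [φ.open_source.mem_nhds hx] with y hy using hu y hy
  constructor
  · filter_upwards [hev.eventuallyEq_nhds,
      PoissonStructure.smoothNear_clm_comp h.chart l hx] with y hy hyl
    exact hyl.congr_of_eventuallyEq hy
  · rw [PoissonStructure.mvfderiv_congr hev, mvfderiv_clm_comp l (h.chart.mdifferentiableAt hx)]

theorem p_spec (hx : x ∈ φ.source) (i : Fin r) (v : TangentSpace 𝓘(ℝ, E) x) :
    SmoothNear E (p i) x ∧ mvfderiv 𝓘(ℝ, E) (p i) x v =
      (mfderiv 𝓘(ℝ, E) 𝓘(ℝ, PQZ r s) φ x v : PQZ r s).1 i :=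
  h.mvfderiv_of_eq ((ContinuousLinearMap.proj (R := ℝ) (φ := fun _ => ℝ) i).comp
    (ContinuousLinearMap.fst ℝ _ _)) (fun y hy => by rw [h.apply y hy]; rfl) hx v

theorem q_spec (hx : x ∈ φ.source) (i : Fin r) (v : TangentSpace 𝓘(ℝ, E) x) :
    SmoothNear E (q i) x ∧ mvfderiv 𝓘(ℝ, E) (q i) x v =
      (mfderiv 𝓘(ℝ, E) 𝓘(ℝ, PQZ r s) φ x v : PQZ r s).2.1 i :=
  h.mvfderiv_of_eq ((ContinuousLinearMap.proj (R := ℝ) (φ := fun _ => ℝ) i).comp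
    ((ContinuousLinearMap.fst ℝ _ _).comp (ContinuousLinearMap.snd ℝ _ _)))
    (fun y hy => by rw [h.apply y hy]; rfl) hx v

theorem z_spec (hx : x ∈ φ.source) (i : Fin s) (v : TangentSpace 𝓘(ℝ, E) x) :
    SmoothNear E (z i) x ∧ mvfderiv 𝓘(ℝ, E) (z i) x v =
      (mfderiv 𝓘(ℝ, E) 𝓘(ℝ, PQZ r s) φ x v : PQZ r s).2.2 i :=
  h.mvfderiv_of_eq ((ContinuousLinearMap.proj (R := ℝ) (φ := fun _ => ℝ) i).comp
    ((ContinuousLinearMap.snd ℝ _ _).comp (ContinuousLinearMap.snd ℝ _ _)))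
    (fun y hy => by rw [h.apply y hy]; rfl) hx v

theorem tangent_ext (hx : x ∈ φ.source) {v w : TangentSpace 𝓘(ℝ, E) x}
    (hp : ∀ i, mvfderiv 𝓘(ℝ, E) (p i) x v = mvfderiv 𝓘(ℝ, E) (p i) x w)
    (hq : ∀ i, mvfderiv 𝓘(ℝ, E) (q i) x v = mvfderiv 𝓘(ℝ, E) (q i) x w)
    (hz : ∀ i, mvfderiv 𝓘(ℝ, E) (z i) x v = mvfderiv 𝓘(ℝ, E) (z i) x w) : v = w := by
  have h1 : (mfderiv 𝓘(ℝ, E) 𝓘(ℝ, PQZ r s) φ x v : PQZ r s) =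
      (mfderiv 𝓘(ℝ, E) 𝓘(ℝ, PQZ r s) φ x w : PQZ r s) := by
    refine Prod.ext (funext fun i => ?_) (Prod.ext (funext fun i => ?_) (funext fun i => ?_))
    · rw [← (h.p_spec hx i v).2, ← (h.p_spec hx i w).2, hp]
    · rw [← (h.q_spec hx i v).2, ← (h.q_spec hx i w).2, hq]
    · rw [← (h.z_spec hx i v).2, ← (h.z_spec hx i w).2, hz]
  rw [← h.chart.mfderiv_symm_mfderiv hx v, ← h.chart.mfderiv_symm_mfderiv hx w]
  exact congrArg (mfderiv 𝓘(ℝ, PQZ r s) 𝓘(ℝ, E) φ.symm (φ x) : PQZ r s →L[ℝ] E) h1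

theorem p_coordVector (hx : x ∈ φ.source) (i : Fin r) (w : PQZ r s) :
    mvfderiv 𝓘(ℝ, E) (p i) x (coordVector φ w x) = w.1 i := by
  rw [(h.p_spec hx i _).2]
  exact congrArg (fun a : PQZ r s => a.1 i) (h.chart.mfderiv_mfderiv_symm hx w)

theorem q_coordVector (hx : x ∈ φ.source) (i : Fin r) (w : PQZ r s) :
    mvfderiv 𝓘(ℝ, E) (q i) x (coordVector φ w x) = w.2.1 i := by
  rw [(h.q_spec hx i _).2]
  exact congrArg (fun a : PQZ r s => a.2.1 i) (h.chart.mfderiv_mfderiv_symm hx w)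

theorem z_coordVector (hx : x ∈ φ.source) (i : Fin s) (w : PQZ r s) :
    mvfderiv 𝓘(ℝ, E) (z i) x (coordVector φ w x) = w.2.2 i := by
  rw [(h.z_spec hx i _).2]
  exact congrArg (fun a : PQZ r s => a.2.2 i) (h.chart.mfderiv_mfderiv_symm hx w)

theorem eq_sum_partial (hx : x ∈ φ.source) (v : TangentSpace 𝓘(ℝ, E) x) :
    v = ∑ i, mvfderiv 𝓘(ℝ, E) (p i) x v • partialP φ i x +
      ∑ i, mvfderiv 𝓘(ℝ, E) (q i) x v • partialQ φ i x +
      ∑ i, mvfderiv 𝓘(ℝ, E) (z i) x v • partialZ φ i x := by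
  refine h.tangent_ext hx (fun i => ?_) (fun i => ?_) fun i => ?_ <;>
  simp only [map_add, map_sum, map_smul, partialP, partialQ, partialZ, h.p_coordVector hx,
    h.q_coordVector hx, h.z_coordVector hx, Pi.single_apply, Pi.zero_apply, smul_eq_mul, mul_zero,
    mul_ite, mul_one, Finset.sum_ite_eq, Finset.sum_const_zero, Finset.mem_univ, if_true, add_zero,
    zero_add]

theorem hamiltonian_p (hx : x ∈ φ.source) (i : Fin r) :
    P.hamiltonian (p i) x = partialQ φ i x := by
  refine h.tangent_ext hx (fun j => ?_) (fun j => ?_) fun j => ?_ <;>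
  simp only [← P.bracket_eq_mvfderiv, h.pp x hx, h.qp x hx, h.zp x hx, partialQ,
    h.p_coordVector hx, h.q_coordVector hx, h.z_coordVector hx, Pi.single_apply, Pi.zero_apply]

theorem hamiltonian_q (hx : x ∈ φ.source) (i : Fin r) :
    P.hamiltonian (q i) x = -partialP φ i x := by
  refine h.tangent_ext hx (fun j => ?_) (fun j => ?_) fun j => ?_
  · rw [← P.bracket_eq_mvfderiv, P.bracket_swap, h.qp x hx, map_neg, partialP,
      h.p_coordVector hx]
    simp [Pi.single_apply, eq_comm]
  · rw [← P.bracket_eq_mvfderiv, h.qq x hx, map_neg, partialP, h.q_coordVector hx]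
    simp
  · rw [← P.bracket_eq_mvfderiv, h.zq x hx, map_neg, partialP, h.z_coordVector hx]
    simp

theorem hamiltonian_z (hx : x ∈ φ.source) (i : Fin s) :
    P.hamiltonian (z i) x = ∑ k, P.bracket (z k) (z i) x • partialZ φ k x := by
  refine h.tangent_ext hx (fun j => ?_) (fun j => ?_) fun j => ?_
  · rw [← P.bracket_eq_mvfderiv, P.bracket_swap, h.zp x hx, map_sum]
    simp [partialZ, h.p_coordVector hx]
  · rw [← P.bracket_eq_mvfderiv, P.bracket_swap, h.zq x hx, map_sum]
    simp [partialZ, h.q_coordVector hx]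
  · rw [← P.bracket_eq_mvfderiv, map_sum]
    simp [partialZ, h.z_coordVector hx, Pi.single_apply]

/-- Skew-symmetry gives du(sharp β) = −β(X_u) for every function u, so the components of sharp β
come from the Hamiltonian fields of the coordinates. -/
theorem sharp_eq (hx : x ∈ φ.source) (β : TangentSpace 𝓘(ℝ, E) x →L[ℝ] ℝ) :
    P.sharp x β = ∑ i, (-β (partialQ φ i x)) • partialP φ i x +
      ∑ i, β (partialP φ i x) • partialQ φ i x +
      ∑ i, (-β (P.hamiltonian (z i) x)) • partialZ φ i x := by
  have hs : ∀ u : M → ℝ, mvfderiv 𝓘(ℝ, E) u x (P.sharp x β) = -β (P.hamiltonian u x) :=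
    fun u => P.skew x _ _
  conv_lhs => rw [h.eq_sum_partial hx (P.sharp x β)]
  simp only [hs, h.hamiltonian_p hx, h.hamiltonian_q hx, map_neg, neg_neg]

/-- The factor 2 in `hc` reflects that the double sum meets each pair {i, j} twice: the coefficients
are half the brackets. -/
theorem bivector_eq (hx : x ∈ φ.source) {c : Fin s → Fin s → ℝ}
    (hc : ∀ i j, P.bracket (z i) (z j) x = 2 * c i j) (α β : TangentSpace 𝓘(ℝ, E) x →L[ℝ] ℝ) :
    P.bivector x α β = ∑ i, wedge (partialQ φ i x) (partialP φ i x) α β +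
      ∑ i, ∑ j, c i j * wedge (partialZ φ i x) (partialZ φ j x) α β := by
  have hskew : ∀ i j, c i j = -c j i := fun i j => by
    have := P.bracket_swap (f := z i) (g := z j) (x := x)
    rw [hc, hc] at this
    linarith
  have h1 : ∑ i, ∑ j, c i j * (α (partialZ φ j x) * β (partialZ φ i x)) =
      -∑ i, ∑ j, c i j * (α (partialZ φ i x) * β (partialZ φ j x)) := by
    rw [Finset.sum_comm, ← Finset.sum_neg_distrib]
    refine Finset.sum_congr rfl fun i _ => ?_
    rw [← Finset.sum_neg_distrib]
    refine Finset.sum_congr rfl fun j _ => ?_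
    rw [hskew j i]
    ring
  have h2 : ∀ i, β (P.hamiltonian (z i) x) = -∑ j, 2 * c i j * β (partialZ φ j x) := fun i => by
    rw [h.hamiltonian_z hx, map_sum, ← Finset.sum_neg_distrib]
    refine Finset.sum_congr rfl fun j _ => ?_
    rw [map_smul, hc, hskew, smul_eq_mul]
    ring
  rw [PoissonStructure.bivector, h.sharp_eq hx β]
  simp only [map_add, map_sum, map_smul, smul_eq_mul, wedge, h2, neg_neg, mul_sub,
    Finset.sum_sub_distrib, h1]
  rw [← Finset.sum_add_distrib, ← Finset.sum_sub_distrib, sub_neg_eq_add]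
  congr 1
  · exact Finset.sum_congr rfl fun i _ => by ring
  · rw [← Finset.sum_add_distrib]
    refine Finset.sum_congr rfl fun i _ => ?_
    rw [Finset.sum_mul, ← Finset.sum_add_distrib]
    exact Finset.sum_congr rfl fun j _ => by ring

/-- A function commuting with all z_i commutes with their brackets, by Jacobi. It is applied with f
one of the coordinates p_k, q_k. -/
theorem bracket_bracket_z_eq_zero (hx : x ∈ φ.source) (i j : Fin s) {f : M → ℝ}
    (hf : SmoothNear E f x) (hzf : ∀ y ∈ φ.source, ∀ i, P.bracket (z i) f y = 0) :
    P.bracket (P.bracket (z i) (z j)) f x = 0 := by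
  have hj := P.jacobi_identity (h.z_spec hx i 0).1 (h.z_spec hx j 0).1 hf
  have hU := φ.open_source.mem_nhds hx
  have h1 : P.bracket (P.bracket (z j) f) (z i) x = 0 := by
    refine P.bracket_const_left (c := 0) ?_
    filter_upwards [hU] with y hy using hzf y hy j
  have h2 : P.bracket (P.bracket f (z i)) (z j) x = 0 := by
    refine P.bracket_const_left (c := 0) ?_
    filter_upwards [hU] with y hy
    rw [P.bracket_swap, hzf y hy i, neg_zero]
  linarith

/-- The brackets `{z i, z j}` are functions of `z` alone, if the domain is a box in `p` and `q`. -/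
theorem bracket_z_eq {B : Set (Fin r → ℝ)} {W : Set (Fin s → ℝ)} (hB : IsOpen B) (hBc : Convex ℝ B)
    (hB0 : 0 ∈ B) (ht : φ.target = B ×ˢ B ×ˢ W) (hx : x ∈ φ.source) (i j : Fin s) :
    P.bracket (z i) (z j) x = P.bracket (z i) (z j) (φ.symm (0, 0, fun k => z k x)) := by
  set b := P.bracket (z i) (z j)
  have hxt : φ x ∈ B ×ˢ B ×ˢ W := ht ▸ φ.map_source hx
  rw [h.apply x hx] at hxt
  set ζ : Fin s → ℝ := fun k => z k x
  let ins : (Fin r → ℝ) × (Fin r → ℝ) → PQZ r s := fun a => (a.1, a.2, ζ)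
  have hins : ∀ a, HasFDerivAt ins ((ContinuousLinearMap.fst ℝ (Fin r → ℝ) (Fin r → ℝ)).prod
      ((ContinuousLinearMap.snd ℝ (Fin r → ℝ) (Fin r → ℝ)).prod 0)) a := fun a =>
    hasFDerivAt_fst.prodMk (hasFDerivAt_snd.prodMk (hasFDerivAt_const ζ a))
  have hd : ∀ a ∈ B ×ˢ B, HasFDerivAt (𝕜 := ℝ)
      (fun a : (Fin r → ℝ) × (Fin r → ℝ) => b (φ.symm (ins a))) 0 a := by
    intro a ha
    have hat : ins a ∈ φ.target := ht ▸ ⟨ha.1, ha.2, hxt.2.2⟩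
    set y := φ.symm (ins a)
    have hy : y ∈ φ.source := φ.map_target hat
    have hφy : φ y = ins a := φ.right_inv hat
    have hbs : SmoothNear E b y := P.smoothNear_bracket (h.z_spec hy i 0).1 (h.z_spec hy j 0).1
    have h1 : DifferentiableAt ℝ (b ∘ φ.symm) (ins a) := by
      rw [← hφy]
      exact ((h.chart.contMDiffAt_iff hy).1 hbs.contMDiffAt).differentiableAt (by simp)
    refine (h1.hasFDerivAt.comp a (hins a)).congr_fderiv ?_
    refine ContinuousLinearMap.ext fun w => ?_
    change fderiv ℝ (b ∘ φ.symm) (ins a) ((w.1, w.2, 0) : PQZ r s) = 0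
    have h2 : ∀ v : PQZ r s, mvfderiv 𝓘(ℝ, E) b y (coordVector φ v y) =
        fderiv ℝ (b ∘ φ.symm) (ins a) v := fun v => by
      rw [h.chart.mvfderiv_apply hy hbs.mdifferentiableAt, hφy]
      exact congrArg (fderiv ℝ (b ∘ φ.symm) (ins a)) (h.chart.mfderiv_mfderiv_symm hy v)
    -- Bracketing with q_k is differentiation along −∂/∂p_k, and bracketing with p_k is
    -- differentiation along ∂/∂q_k; `b` commutes with both.
    have hP : ∀ k, mvfderiv 𝓘(ℝ, E) b y (partialP φ k y) = 0 := fun k => by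
      have := h.bracket_bracket_z_eq_zero hy i j (h.q_spec hy k 0).1 fun y hy l => h.zq y hy l k
      rw [P.bracket_eq_mvfderiv, h.hamiltonian_q hy, map_neg] at this
      linarith
    have hQ : ∀ k, mvfderiv 𝓘(ℝ, E) b y (partialQ φ k y) = 0 := fun k => by
      have := h.bracket_bracket_z_eq_zero hy i j (h.p_spec hy k 0).1 fun y hy l => h.zp y hy l k
      rwa [P.bracket_eq_mvfderiv, h.hamiltonian_p hy] at this
    rw [← h2, h.eq_sum_partial hy (coordVector φ _ y)]
    simp only [map_add, map_sum, map_smul, hP, hQ, h.z_coordVector hy]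
    simp
  have hconst := IsOpen.is_const_of_fderiv_eq_zero (𝕜 := ℝ) (f := fun a : (Fin r → ℝ) × (Fin r → ℝ) => b (φ.symm (ins a)))
    (hB.prod hB) (hBc.prod hBc).isPreconnected
    (fun a ha => (hd a ha).differentiableAt.differentiableWithinAt)
    (fun a ha => (hd a ha).fderiv) (x := (fun i => p i x, fun i => q i x)) (y := (0, 0))
    ⟨hxt.1, hxt.2.1⟩ ⟨hB0, hB0⟩
  have hxe : φ.symm (ins (fun i => p i x, fun i => q i x)) = x := by
    simp only [ins, ζ]
    rw [← h.apply x hx, φ.left_inv hx]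
  simp only [hxe] at hconst
  exact hconst

end IsSplittingChart

/-! ### The rank of the Poisson structure -/

section Rank

variable {E M : Type*} [NormedAddCommGroup E] [NormedSpace ℝ E] [FiniteDimensional ℝ E]
  [TopologicalSpace M] [ChartedSpace E M] {P : PoissonStructure E M}
  {r s : ℕ} {φ : OpenPartialHomeomorph M (PQZ r s)} {p q : Fin r → M → ℝ} {z : Fin s → M → ℝ}
  {x : M}

/-- The 2r independent vectors X_{p_i}, X_{q_i} lie in the image of sharp, so rank 2r means that
they span it. Then each X_{z_j} is a combination of them and is killed by dz_i. Conversely,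
vanishing brackets give X_{z_j} = 0, and `sharp_eq` leaves only the span. -/
theorem IsSplittingChart.rank_eq_iff (h : IsSplittingChart P φ p q z) (hx : x ∈ φ.source)
    (hind : LinearIndependent ℝ fun i => P.hamiltonian (p i) x) :
    P.rank x = 2 * r ↔ ∀ i j, P.bracket (z i) (z j) x = 0 := by
  have : FiniteDimensional ℝ (TangentSpace 𝓘(ℝ, E) x) := inferInstanceAs (FiniteDimensional ℝ E)
  have hind' : LinearIndependent ℝ fun i => P.hamiltonian (Sum.elim p q i) x :=
    P.linearIndependent_hamiltonian_sumElim (σ' := id) Function.injective_id (h.pp x hx)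
      (h.qp x hx) hind
  set S := Submodule.span ℝ (range fun i => P.hamiltonian (Sum.elim p q i) x) with hS
  have hcard : Module.finrank ℝ S = 2 * r := by
    rw [hS, finrank_span_eq_card hind', Fintype.card_sum, Fintype.card_fin, two_mul]
  have hle : S ≤ LinearMap.range (P.sharp x) := by
    refine Submodule.span_le.2 ?_
    rintro _ ⟨i, rfl⟩
    exact ⟨_, rfl⟩
  have hp : ∀ i, P.hamiltonian (p i) x ∈ S := fun i => Submodule.subset_span ⟨Sum.inl i, rfl⟩
  have hq : ∀ i, P.hamiltonian (q i) x ∈ S := fun i => Submodule.subset_span ⟨Sum.inr i, rfl⟩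
  constructor
  · intro hr i j
    have heq : S = LinearMap.range (P.sharp x) :=
      Submodule.eq_of_le_of_finrank_eq hle (hcard.trans hr.symm)
    have hz : P.hamiltonian (z j) x ∈ S := heq ▸ ⟨_, rfl⟩
    rw [P.bracket_eq_mvfderiv]
    refine Submodule.span_induction (p := fun v _ => mvfderiv 𝓘(ℝ, E) (z i) x v = 0) ?_
      (map_zero _) (fun v w _ _ hv hw => by rw [map_add, hv, hw, add_zero])
      (fun a v _ hv => by rw [map_smul, hv, smul_zero]) hz
    rintro _ ⟨k | k, rfl⟩
    · exact h.zp x hx i k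
    · exact h.zq x hx i k
  · intro hz
    refine Eq.trans ?_ hcard
    rw [PoissonStructure.rank, le_antisymm ?_ hle]
    rintro _ ⟨β, rfl⟩
    rw [h.sharp_eq hx β]
    have hz0 : ∀ i, P.hamiltonian (z i) x = 0 := fun i => by simp [h.hamiltonian_z hx, hz]
    simp only [hz0, map_zero, neg_zero, zero_smul, Finset.sum_const_zero, add_zero]
    refine S.add_mem (S.sum_mem fun i _ => S.smul_mem _ ?_)
      (S.sum_mem fun i _ => S.smul_mem _ ?_)
    · have := S.neg_mem (hq i)
      rwa [h.hamiltonian_q hx, neg_neg] at this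
    · rw [← h.hamiltonian_p hx]
      exact hp i

end Rank

/-! ### Invariant box neighbourhoods -/

section InvariantBox

variable {E M : Type*} [NormedAddCommGroup E] [NormedSpace ℝ E]
  [TopologicalSpace M] [ChartedSpace E M] {G : Type*} [Group G] [TopologicalSpace G]
  [CompactSpace G] [MulAction G M] [ContinuousSMul G M] {m : M} {r s : ℕ}

/-- A chart at a fixed point in which a compact group acts linearly on the last coordinates and
trivially on the others restricts to an arbitrarily small invariant box. -/
theorem exists_invariant_box (hm : ∀ g : G, g • m = m) {φ₀ : OpenPartialHomeomorph M (PQZ r s)}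
    (h₀ : IsSmoothChart E φ₀) (hm₀ : m ∈ φ₀.source) (hφm : φ₀ m = 0)
    {A : G →* Matrix (Fin s) (Fin s) ℝ} (hA : ∀ i j, Continuous fun g => A g i j)
    (hact : ∀ᶠ x in 𝓝 m, ∀ g : G, φ₀ (g • x) = ((φ₀ x).1, (φ₀ x).2.1, A g *ᵥ (φ₀ x).2.2))
    {C : M → Prop} (hC : ∀ᶠ x in 𝓝 m, C x) :
    ∃ (φ : OpenPartialHomeomorph M (PQZ r s)) (B : Set (Fin r → ℝ)) (W : Set (Fin s → ℝ)),
      ⇑φ = φ₀ ∧ IsSmoothChart E φ ∧ m ∈ φ.source ∧ IsOpen B ∧ Convex ℝ B ∧ 0 ∈ B ∧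
      φ.target = B ×ˢ B ×ˢ W ∧ φ.source ⊆ φ₀.source ∧
      ∀ x ∈ φ.source, C x ∧ ∀ g : G, g • x ∈ φ.source := by
  have ht₀ : (0 : PQZ r s) ∈ φ₀.target := hφm ▸ φ₀.map_source hm₀
  have hs₀ : φ₀.symm 0 = m := by rw [← hφm, φ₀.left_inv hm₀]
  have htend : Tendsto φ₀.symm (𝓝 0) (𝓝 m) := by
    have := (φ₀.symm.continuousAt ht₀).tendsto
    rwa [hs₀] at this
  have hev := Eventually.and (φ₀.open_target.mem_nhds ht₀)
    (htend.eventually ((hC.and hact).and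
      (eventually_forall_smul hm (φ₀.open_source.mem_nhds hm₀))))
  obtain ⟨δ, hδ, hball⟩ := Metric.eventually_nhds_iff_ball.1 hev
  let B : Set (Fin r → ℝ) := Metric.ball 0 δ
  -- The ball need not be invariant under A. The points whose whole orbit stays in it form an
  -- invariant set, which is open because G is compact.
  let W : Set (Fin s → ℝ) := {ζ | ∀ g : G, A g *ᵥ ζ ∈ Metric.ball 0 δ}
  have hAc : Continuous fun g => A g := continuous_matrix hA
  have hW : IsOpen W := by
    refine isOpen_iff_mem_nhds.2 fun ζ hζ => ?_
    have := (isCompact_univ (X := G)).eventually_forall_of_forall_eventually (x₀ := ζ)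
      (P := fun ζ g => A g *ᵥ ζ ∈ Metric.ball 0 δ) fun g _ => by
        have hc : Continuous fun w : (Fin s → ℝ) × G => A w.2 *ᵥ w.1 :=
          (hAc.comp continuous_snd).matrix_mulVec continuous_fst
        exact hc.continuousAt.eventually (Metric.isOpen_ball.mem_nhds (hζ g))
    filter_upwards [this] with ζ' hζ' g using hζ' g (mem_univ g)
  have hWA : ∀ ζ ∈ W, ∀ g : G, A g *ᵥ ζ ∈ W := fun ζ hζ g g' => by
    rw [Matrix.mulVec_mulVec, ← map_mul]
    exact hζ _
  have hWδ : ∀ ζ ∈ W, ζ ∈ Metric.ball (0 : Fin s → ℝ) δ := fun ζ hζ => by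
    simpa using hζ 1
  let T : Set (PQZ r s) := B ×ˢ B ×ˢ W
  have hT : IsOpen T := Metric.isOpen_ball.prod (Metric.isOpen_ball.prod hW)
  have hTδ : ∀ y ∈ T, y ∈ Metric.ball (0 : PQZ r s) δ := by
    rintro ⟨a, b, ζ⟩ ⟨ha, hb, hζ⟩
    have h1 := hWδ ζ hζ
    simp only [B, mem_ball_zero_iff] at ha hb h1 ⊢
    exact max_lt ha (max_lt hb h1)
  -- Restricting on the target side makes the image exactly the box.
  let φ := (φ₀.symm.restrOpen T hT).symm
  have hφ : ⇑φ = φ₀ := rfl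
  have hφs : ⇑φ.symm = φ₀.symm := rfl
  have htarget : φ.target = T := inter_eq_right.2 fun y hy => (hball y (hTδ y hy)).1
  have hsource : φ.source ⊆ φ₀.source := fun x hx => by
    have h1 := φ.map_source hx
    rw [htarget] at h1
    rw [← φ.left_inv hx, hφs]
    exact φ₀.map_target (hball _ (hTδ _ h1)).1
  have h0T : (0 : PQZ r s) ∈ T :=
    ⟨Metric.mem_ball_self hδ, Metric.mem_ball_self hδ, fun g => by simpa using hδ⟩
  refine ⟨φ, B, W, hφ, ⟨fun hx => h₀.contMDiffAt (hsource hx), fun hy => h₀.contMDiffAt_symm ?_⟩,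
    ?_, Metric.isOpen_ball, convex_ball _ _, Metric.mem_ball_self hδ, htarget, hsource,
    fun x hx => ?_⟩
  · rw [htarget] at hy
    exact (hball _ (hTδ _ hy)).1
  · rw [← hs₀]
    exact φ.map_target (htarget ▸ h0T)
  · have hxT : φ₀ x ∈ T := htarget ▸ φ.map_source hx
    obtain ⟨-, ⟨hCx, hax⟩, hgx⟩ := hball _ (hTδ _ hxT)
    rw [φ₀.left_inv (hsource hx)] at hCx hax hgx
    refine ⟨hCx, fun g => ?_⟩
    rw [← φ₀.left_inv (hgx g), hax g]
    refine φ.map_target ?_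
    rw [htarget]
    exact ⟨hxT.1, hxT.2.1, hWA _ hxT.2.2 g⟩

end InvariantBox

/-! ### The chart formed by p, q and z -/

section Transverse

variable {E M : Type*} [NormedAddCommGroup E] [NormedSpace ℝ E] [FiniteDimensional ℝ E]
  [TopologicalSpace M] [ChartedSpace E M] [IsManifold 𝓘(ℝ, E) ∞ M] {P : PoissonStructure E M}
  {r s : ℕ} {p q : Fin r → M → ℝ} {z : Fin s → M → ℝ} {m : M}

/-- Conjugate functions `p, q`, completed by functions `z` commuting with them whose differentials
span the annihilator of the Hamiltonian vector fields of `p, q`, form a chart. -/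
theorem exists_isSmoothChart_of_conjugate (hdim : Module.finrank ℝ E = 2 * r + s)
    (hp : ∀ i, SmoothNear E (p i) m) (hq : ∀ i, SmoothNear E (q i) m)
    (hz : ∀ i, SmoothNear E (z i) m) (hpp : ∀ i j, P.bracket (p i) (p j) m = 0)
    (hqp : ∀ i j, P.bracket (q i) (p j) m = if i = j then 1 else 0)
    (hqq : ∀ i j, P.bracket (q i) (q j) m = 0)
    (hspan : ∀ v : TangentSpace 𝓘(ℝ, E) m, (∀ j, mvfderiv 𝓘(ℝ, E) (z j) m v = 0) →
      v ∈ Submodule.span ℝ (range fun i => P.hamiltonian (Sum.elim p q i) m)) :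
    ∃ φ : OpenPartialHomeomorph M (PQZ r s), m ∈ φ.source ∧ IsSmoothChart E φ ∧
      ∀ x ∈ φ.source, φ x = (fun i => p i x, fun i => q i x, fun j => z j x) := by
  let Φ : M → PQZ r s := fun x => (fun i => p i x, fun i => q i x, fun j => z j x)
  have hΦ : ∀ᶠ x in 𝓝 m, ContMDiffAt 𝓘(ℝ, E) 𝓘(ℝ, PQZ r s) ∞ Φ x := by
    filter_upwards [eventually_all.2 hp, eventually_all.2 hq, eventually_all.2 hz] with x h1 h2 h3
    exact (contMDiffAt_pi_space.2 h1).prodMk_space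
      ((contMDiffAt_pi_space.2 h2).prodMk_space (contMDiffAt_pi_space.2 h3))
  refine exists_isSmoothChart_of_mfderiv_injective (by simp [hdim]; ring) hΦ fun v hv => ?_
  have hl : ∀ l : PQZ r s →L[ℝ] ℝ, mvfderiv 𝓘(ℝ, E) (fun x => l (Φ x)) m v = 0 := fun l => by
    rw [mvfderiv_clm_comp l (hΦ.self_of_nhds.mdifferentiableAt (by simp)), hv]
    exact map_zero l
  have hpv : ∀ i, mvfderiv 𝓘(ℝ, E) (p i) m v = 0 := fun i =>
    hl ((ContinuousLinearMap.proj (R := ℝ) (φ := fun _ => ℝ) i).comp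
      (ContinuousLinearMap.fst ℝ _ _))
  have hqv : ∀ i, mvfderiv 𝓘(ℝ, E) (q i) m v = 0 := fun i =>
    hl ((ContinuousLinearMap.proj (R := ℝ) (φ := fun _ => ℝ) i).comp
      ((ContinuousLinearMap.fst ℝ _ _).comp (ContinuousLinearMap.snd ℝ _ _)))
  have hzv : ∀ i, mvfderiv 𝓘(ℝ, E) (z i) m v = 0 := fun i =>
    hl ((ContinuousLinearMap.proj (R := ℝ) (φ := fun _ => ℝ) i).comp
      ((ContinuousLinearMap.snd ℝ _ _).comp (ContinuousLinearMap.snd ℝ _ _)))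
  -- A vector killed by every dz_j is a combination of the X_{p_i} and X_{q_i}. The differentials
  -- dq_i and dp_i return its coefficients up to sign, so all of them vanish.
  obtain ⟨a, rfl⟩ := (Submodule.mem_span_range_iff_exists_fun ℝ).1 (hspan v hzv)
  simp only [Fintype.sum_sum_type, Sum.elim_inl, Sum.elim_inr, map_add, map_sum, map_smul,
    ← P.bracket_eq_mvfderiv] at hpv hqv ⊢
  have hpq : ∀ i j, P.bracket (p i) (q j) m = -if j = i then 1 else 0 := fun i j => by
    rw [P.bracket_swap, hqp]
  have ha : ∀ i, a (Sum.inl i) = 0 := fun i => by simpa [hqp, hqq] using hqv i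
  have hb : ∀ i, a (Sum.inr i) = 0 := fun i => by simpa [hpp, hpq] using hpv i
  simp [ha, hb]

end Transverse

/-! ### The equivariant splitting theorem -/

theorem mainTheorem1
    (r s : ℕ)
    {E : Type*} [NormedAddCommGroup E] [NormedSpace ℝ E] [FiniteDimensional ℝ E]
    (hdim : Module.finrank ℝ E = 2 * r + s)
    {M : Type*} [TopologicalSpace M] [T2Space M] [SecondCountableTopology M]
    [ChartedSpace E M] [IsManifold 𝓘(ℝ, E) ∞ M]
    (P : PoissonStructure E M)
    {EG : Type*} [NormedAddCommGroup EG] [NormedSpace ℝ EG] [FiniteDimensional ℝ EG]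
    {G : Type*} [Group G] [TopologicalSpace G] [T2Space G] [CompactSpace G]
    [ChartedSpace EG G] [LieGroup 𝓘(ℝ, EG) ∞ G]
    [MulAction G M] [ContMDiffSMul 𝓘(ℝ, EG) 𝓘(ℝ, E) ∞ G M]
    (hP : ∀ g : G, P.IsPreservedBy (fun x : M => g • x))
    (m : M) (hm : ∀ g : G, g • m = m)
    (V : Set M) (hV : IsOpen V) (hmV : m ∈ V)
    (p : Fin r → M → ℝ)
    (hp : ∀ i, ContMDiffOn 𝓘(ℝ, E) 𝓘(ℝ, ℝ) ∞ (p i) V)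
    (hp_inv : ∀ (g : G) (x : M), x ∈ V → g • x ∈ V → ∀ i, p i (g • x) = p i x)
    (hp_comm : ∀ x ∈ V, ∀ i j, P.bracket (p i) (p j) x = 0)
    (hp_zero : ∀ i, p i m = 0)
    (hp_indep : LinearIndependent ℝ (fun i => P.hamiltonian (p i) m)) :
    ∃ (U : Set M) (q : Fin r → M → ℝ) (z : Fin s → M → ℝ)
      (φ : OpenPartialHomeomorph M (PQZ r s))
      (c : Fin s → Fin s → (Fin s → ℝ) → ℝ) (A : G →* GL (Fin s) ℝ),
      IsOpen U ∧ m ∈ U ∧ U ⊆ V ∧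
      -- the functions `p, q, z` are local coordinates on `U`, centered at `m`
      φ.source = U ∧ IsSmoothCoordinates (E := E) φ ∧
      (∀ x ∈ U, φ x = (fun i => p i x, fun i => q i x, fun j => z j x)) ∧
      φ m = 0 ∧
      -- the coefficients are skew-symmetric smooth functions of `z` alone
      (∀ i j, ContDiffOn ℝ ∞ (c i j) ((fun x j => z j x) '' U)) ∧
      (∀ i j, ∀ x ∈ U, c i j (fun k => z k x) = -c j i (fun k => z k x)) ∧
      -- the Poisson structure in these coordinates
      (∀ x ∈ U, ∀ α β : TangentSpace 𝓘(ℝ, E) x →L[ℝ] ℝ,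
        P.bivector x α β =
          ∑ i, wedge (partialQ φ i x) (partialP φ i x) α β +
          ∑ i, ∑ j, c i j (fun k => z k x) * wedge (partialZ φ i x) (partialZ φ j x) α β) ∧
      -- the action of `G` in these coordinates
      (∀ g : G, ∀ x ∈ U, g • x ∈ U ∧
        (∀ i, p i (g • x) = p i x) ∧ (∀ i, q i (g • x) = q i x) ∧
        (fun j => z j (g • x)) = (A g : Matrix (Fin s) (Fin s) ℝ) *ᵥ (fun j => z j x)) ∧
      -- the rank at `m`
      (P.rank m = 2 * r ↔ ∀ i j, c i j 0 = 0) := by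
  have hsm : ContinuousSMul G M :=
    ContMDiffSMul.continuousSMul (I := 𝓘(ℝ, EG)) (I' := 𝓘(ℝ, E)) (G := G) (M := M) ∞
  have hVm : ∀ᶠ x in 𝓝 m, x ∈ V := hV.mem_nhds hmV
  have hps : ∀ i, SmoothNear E (p i) m := fun i => SmoothNear.of_contMDiffOn hV hmV (hp i)
  -- `hp_inv` needs both x and g x in V; near the fixed point the whole orbit of x stays in V.
  have hpinv : ∀ i, ∀ᶠ x in 𝓝 m, ∀ g : G, p i (g • x) = p i x := fun i => by
    filter_upwards [hVm, eventually_forall_smul hm hVm] with x hx hgx g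
    exact hp_inv g x hx (hgx g) i
  have hpp : ∀ i j, ∀ᶠ x in 𝓝 m, P.bracket (p i) (p j) x = 0 := fun i j => by
    filter_upwards [hVm] with x hx using hp_comm x hx i j
  obtain ⟨q, hqs, hq0, hqinv, hqp, hqq⟩ :=
    exists_invariant_conjugate (EG := EG) P hP hm hps hpinv hpp hp_indep
  have hpq : ∀ i j, ∀ᶠ x in 𝓝 m, P.bracket (p i) (q j) x = -if j = i then 1 else 0 := fun i j => by
    filter_upwards [hqp j i] with x hx
    rw [P.bracket_swap, hx]
  have hind := P.linearIndependent_hamiltonian_sumElim (σ' := id) Function.injective_id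
    (fun i j => (hpp i j).self_of_nhds) (fun i j => (hqp i j).self_of_nhds) hp_indep
  obtain ⟨z, A, hzs, hz0, hzf, hA, hzA, hspan⟩ := exists_equivariant_transverse (EG := EG) P hP hm
    (f := Sum.elim p q) (by rintro (i | i); exacts [hps i, hqs i])
    (by rintro (i | i); exacts [hpinv i, Eventually.of_forall fun x g => hqinv i g x])
    (by
      rintro (i | i) (j | j)
      exacts [⟨_, hpp i j⟩, ⟨_, hpq i j⟩, ⟨_, hqp i j⟩, ⟨_, hqq i j⟩])
    hind (s := s) (by rw [hdim, Fintype.card_sum, Fintype.card_fin, two_mul])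
  obtain ⟨φ₀, hm₀, h₀, hφ₀⟩ := exists_isSmoothChart_of_conjugate hdim hps hqs hzs
    (fun i j => (hpp i j).self_of_nhds) (fun i j => (hqp i j).self_of_nhds)
    (fun i j => (hqq i j).self_of_nhds) hspan
  have hφm : φ₀ m = 0 := by
    rw [hφ₀ m hm₀]
    simp only [hp_zero, hq0, hz0]
    rfl
  have hsrc : ∀ᶠ x in 𝓝 m, x ∈ φ₀.source := φ₀.open_source.mem_nhds hm₀
  have hact : ∀ᶠ x in 𝓝 m, ∀ g : G,
      φ₀ (g • x) = ((φ₀ x).1, (φ₀ x).2.1, A g *ᵥ (φ₀ x).2.2) := by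
    filter_upwards [hsrc, eventually_forall_smul hm hsrc, eventually_all.2 hpinv, hzA]
      with x hx hgx hpx hzx g
    rw [hφ₀ _ (hgx g), hφ₀ x hx, hzx g]
    simp only [hpx _ g, hqinv]
  have hC := (hVm.and (eventually_all.2 fun i => eventually_all.2 (hpp i))).and
    ((eventually_all.2 fun i => eventually_all.2 (hqp i)).and
    ((eventually_all.2 fun i => eventually_all.2 (hqq i)).and
    ((eventually_all.2 fun i => eventually_all.2 (hzf i)).and
    ((eventually_all.2 hpinv).and hzA))))
  obtain ⟨φ, B, W, hφ, hχ, hmφ, hB, hBc, hB0, htarget, hle, hCφ⟩ :=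
    exists_invariant_box hm h₀ hm₀ hφm hA hact hC
  have happly : ∀ x ∈ φ.source, φ x = (fun i => p i x, fun i => q i x, fun j => z j x) :=
    fun x hx => by rw [hφ, hφ₀ x (hle hx)]
  have h : IsSplittingChart P φ p q z :=
    { chart := hχ
      apply := happly
      pp := fun x hx => (hCφ x hx).1.1.2
      qp := fun x hx => (hCφ x hx).1.2.1
      qq := fun x hx => (hCφ x hx).1.2.2.1
      zp := fun x hx i j => (hCφ x hx).1.2.2.2.1 i (Sum.inl j)
      zq := fun x hx i j => (hCφ x hx).1.2.2.2.1 i (Sum.inr j) }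
  -- Half the brackets, as each pair occurs twice in the double sum, evaluated on the slice p = q =
  -- 0 to give functions of z alone.
  let c : Fin s → Fin s → (Fin s → ℝ) → ℝ := fun i j ζ =>
    2⁻¹ * P.bracket (z i) (z j) (φ.symm (0, 0, ζ))
  have hc : ∀ x ∈ φ.source, ∀ i j, P.bracket (z i) (z j) x = 2 * c i j (fun k => z k x) :=
    fun x hx i j => by
      rw [h.bracket_z_eq hB hBc hB0 htarget hx i j]
      simp only [c]
      ring
  have hcm : ∀ i j, P.bracket (z i) (z j) m = 2 * c i j 0 := fun i j => by
    rw [hc m hmφ]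
    simp only [hz0]
    rfl
  refine ⟨φ.source, q, z, φ, c, A.toHomUnits, φ.open_source, hmφ, fun x hx => (hCφ x hx).1.1.1, rfl,
    ⟨fun x hx => (hχ.contMDiffAt hx).contMDiffWithinAt,
      fun y hy => (hχ.contMDiffAt_symm hy).contMDiffWithinAt⟩, happly, by rw [hφ, hφm], ?_, ?_,
    fun x hx α β => h.bivector_eq hx (hc x hx) α β, ?_, ?_⟩
  · rintro i j _ ⟨x, hx, rfl⟩
    refine ContDiffAt.contDiffWithinAt (contDiffAt_const.mul ?_)
    have hxt := htarget ▸ φ.map_source hx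
    rw [happly x hx] at hxt
    have hyt : ((0, 0, fun k => z k x) : PQZ r s) ∈ φ.target := htarget ▸ ⟨hB0, hB0, hxt.2.2⟩
    have hy := φ.map_target hyt
    have h1 := (hχ.contMDiffAt_iff hy).1
      (P.smoothNear_bracket (h.z_spec hy i 0).1 (h.z_spec hy j 0).1).contMDiffAt
    rw [φ.right_inv hyt] at h1
    exact h1.comp (f := fun ζ : Fin s → ℝ => ((0, 0, ζ) : PQZ r s)) _
      (contDiffAt_const.prodMk (contDiffAt_const.prodMk contDiffAt_id))
  · intro i j x hx
    have h1 := P.bracket_swap (f := z i) (g := z j) (x := x)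
    rw [hc x hx, hc x hx] at h1
    linarith
  · intro g x hx
    obtain ⟨⟨-, -, -, -, hpx, hzx⟩, hgx⟩ := hCφ x hx
    exact ⟨hgx g, fun i => hpx i g, fun i => hqinv i g x, hzx g⟩
  · rw [h.rank_eq_iff hmφ hp_indep]
    simp [hcm]
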